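/- **Setting.** A *Boolean polynomial* in $n$ variables is an element of $\mathbb F_2[x_1,\dots,x_n]/(x_1^2-x_1,\dots,x_n^2-x_n)$, written in its canonical form, i.e. as a sum of distinct square-free monomials. $\mathrm{term}(P)$ is the number of monomials of $P$. The *class* of a non-constant $P$ is the largest $c$ such that $x_c$ occurs in $P$; then $P=Ix_c+U$ with $I,U$ free of $x_c$. For $P=x_c+U_1$ and $Q=x_c+U_2$ of class $c$ the pseudo-remainder is $\mathrm{prem}(P,Q)=U_1+U_2$. **Algorithm MFTriSet** (input: a finite set $\mathcal P$ of Boolean polynomials). Put $\mathcal P^*=\emptyset$, $\mathcal A=\emptyset$, and repeat the following pass; the polynomial $0$ is discarded from $\mathcal P$ at the start of each pass. 1. If $\mathcal P=\emptyset$, return $\mathcal A$ and $\mathcal P^*$. If $1\in\mathcal P$, return $\emptyset$ and $\mathcal P^*$. 2. Let $c$ be the highest class occurring in $\mathcal P$, let $\mathcal P_1$ be the set of the polynomials of class $c$ in $\mathcal P$, and put $\mathcal Q_1=\mathcal P\setminus\mathcal P_1$, $\mathcal P_2=\emptyset$. 3. While $\mathcal P_1\neq\emptyset$: take some $P=Ix_c+U$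 out of $\mathcal P_1$; add the system $\mathcal P_1\cup\mathcal Q_1\cup\mathcal P_2\cup\mathcal A\cup\{I,U\}$ to $\mathcal P^*$; then add $x_c+U$ to $\mathcal P_2$ and $I+1$ to $\mathcal Q_1$. 4. Let $Q$ be a polynomial of lowest total degree in $\mathcal P_2$. Add $Q$ to $\mathcal A$ and replace $\mathcal P$ by $\mathcal Q_1\cup\{\mathrm{prem}(P,Q)\neq0 : P\in\mathcal P_2\}$. **Cost.** The algorithm is implemented on bits, lists and binary trees: a monomial is a string of $n$ bits, a polynomial is the lexicographically ordered list of its monomials, a set of polynomials is a list (repetitions in $\mathcal P$ are removed at the start of each pass), and the systems put into $\mathcal P^*$ refer to the polynomial lists that they are made of instead of copying them. The *bitsize complexity* is the number of elementary steps, a step being the inspection of one bit or of one list or tree cell (with a bounded number of cell constructions). Everything is counted: addition and splitting of polynomials, finding classes and degrees, comparisons, and operations on the sets. The choices left open by the algorithm (the order in which the elements of $\mathcal P_1$ are taken, and which polynomial of lowest degree is $Q$) may be made by any rule; the time of the rule itself is not counted. The *input size* of $\mathcal P$ is the number of bits $\sum_{P\in\mathcal P}\bigl((n+1)\,\mathrm{term}(P)+1\bigr)$.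 **Theorem.** (1) There is an absolute constant $C$ such that for all $n\ge1$, $d\ge0$, every finite set $\mathcal P$ of $l$ Boolean polynomials in $n$ variables of total degree at most $d$ that contains a nonzero polynomial, every order in which $\mathcal P$ is listed and every choice rule, MFTriSet halts on $\mathcal P$ after at most $$C\,l\,n^{d+1}\sum_{P\in\mathcal P}\mathrm{term}(P)$$ elementary steps; and if $l\ge n$, after at most $C\,l\,n^{d+2}M$ elementary steps, where $M=\max_{P\in\mathcal P}\mathrm{term}(P)$. (2) For every fixed $d$ there is a polynomial $p$ such that for every $n$, every finite set $\mathcal P$ of Boolean polynomials in $n$ variables of total degree at most $d$, every listing and every choice rule, MFTriSet halts on $\mathcal P$ after at most $p(s)$ elementary steps, where $s$ is the input size of $\mathcal P$. -/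

import Mathlib

namespace MFTri

/-! ## Counting elementary steps

A `Timed α` is a result together with the number of elementary steps spent on it.  Every routine
below works on bits, lists and binary trees, and spends one step (`tick`) at each pattern match,
that is, each time it inspects one bit or one cell.  Data are never copied unless a routine
traverses them: a variable holds a reference, so that several lists may share a common part. -/

structure Timed (α : Type) where
  val : α
  time : ℕ

instance : Monad Timed where
  pure a := ⟨a, 0⟩
  bind x f := ⟨(f x.val).val, x.time + (f x.val).time⟩

def tick : Timed PUnit := ⟨PUnit.unit, 1⟩

/-! ## Representation of Boolean polynomials

A square-free monomial in `x₁, …, xₙ` is stored as the list of its `n` exponents, that of `xₙ`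
first; a Boolean polynomial is stored as the list of its monomials, in decreasing lexicographic
order.  So `[]` is the polynomial `0`, and the leading variable of a polynomial is the first
variable of its first monomial.  The variable in position `j` of such a list is `x₍ₙ₋ⱼ₎`; hence a
higher class means a smaller position.  Positions and degrees are kept in unary. -/

abbrev Mono := List Bool

abbrev Poly := List Mono

/-- The exponent list of a square-free monomial, exponent of the last variable first. -/
def bits {n : ℕ} (m : Fin n →₀ ℕ) : Mono :=
  List.ofFn fun i : Fin n => decide (m i.rev ≠ 0)

/-- The stored form of a Boolean polynomial. -/
noncomputable def encode {n : ℕ} (P : MvPolynomial (Fin n) (ZMod 2)) : Poly :=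
  (P.support.image bits).sort (· ≥ ·)

/-! ## Bit-level routines for polynomials -/

/-- Lexicographic comparison of two monomials (of equal length). -/
def cmpMono : Mono → Mono → Timed Ordering
  | true :: _, false :: _ => do tick; pure .gt
  | false :: _, true :: _ => do tick; pure .lt
  | true :: s, true :: t => do tick; cmpMono s t
  | false :: s, false :: t => do tick; cmpMono s t
  | _, _ => do tick; pure .eq

/-- Sum of two polynomials over the field with two elements, by merging; equal monomials cancel. -/
def add : Poly → Poly → Timed Poly
  | [], q => do tick; pure q
  | m :: p, [] => do tick; pure (m :: p)
  | m :: p, m' :: q => do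
    tick
    match ← cmpMono m m' with
    | .gt => do
      let r ← add p (m' :: q)
      pure (m :: r)
    | .lt => do
      let r ← add (m :: p) q
      pure (m' :: r)
    | .eq => add p q
termination_by p q => p.length + q.length

/-- Whether the variable in position `j` divides the monomial, and the monomial without it. -/
def eraseVar : ℕ → Mono → Timed (Bool × Mono)
  | _, [] => do tick; pure (false, [])
  | 0, b :: m => do tick; pure (b, false :: m)
  | j + 1, b :: m => do
    tick
    let (r, m') ← eraseVar j m
    pure (r, b :: m')

/-- The polynomials `I` and `U` in `P = I x + U`, where `x` is the variable in position `j`. -/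
def split (j : ℕ) : Poly → Timed (Poly × Poly)
  | [] => do tick; pure ([], [])
  | m :: p => do
    tick
    let (b, m') ← eraseVar j m
    let (I, U) ← split j p
    if b then pure (m' :: I, U) else pure (I, m' :: U)

/-- Position of the first variable of a monomial; `none` for the monomial `1`. -/
def leadMono : Mono → Timed (Option ℕ)
  | [] => do tick; pure none
  | true :: _ => do tick; pure (some 0)
  | false :: m => do
    tick
    let r ← leadMono m
    pure (r.map (· + 1))

/-- Position of the leading variable of a polynomial; `none` for a constant (class `0`). -/
def leadPos : Poly → Timed (Option ℕ)
  | [] => do tick; pure none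
  | m :: _ => do tick; leadMono m

/-- Comparison `a ≤ b` of unary numbers. -/
def leU : ℕ → ℕ → Timed Bool
  | 0, _ => do tick; pure true
  | _ + 1, 0 => do tick; pure false
  | a + 1, b + 1 => do tick; leU a b

/-- Degree of a monomial. -/
def degMono : Mono → Timed ℕ
  | [] => do tick; pure 0
  | b :: m => do
    tick
    let k ← degMono m
    pure (if b then k + 1 else k)

/-- Total degree of a polynomial. -/
def deg : Poly → Timed ℕ
  | [] => do tick; pure 0
  | m :: p => do
    tick
    let a ← degMono m
    let b ← deg p
    if ← leU a b then pure b else pure a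

/-- The monomial `1` in `n` variables. -/
def oneMono : ℕ → Timed Mono
  | 0 => do tick; pure []
  | n + 1 => do
    tick
    let m ← oneMono n
    pure (false :: m)

/-- The variable in position `j` as a monomial in `n` variables. -/
def varMono : ℕ → ℕ → Timed Mono
  | 0, _ => do tick; pure []
  | n + 1, 0 => do
    tick
    let m ← oneMono n
    pure (true :: m)
  | n + 1, j + 1 => do
    tick
    let m ← varMono n j
    pure (false :: m)

/-- Is this the polynomial `1`? -/
def isOne : Poly → Timed Bool
  | [m] => do
    tick
    match ← leadMono m with
    | none => pure true
    | some _ => pure false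
  | _ => do tick; pure false

/-! ## Routines for finite sets of polynomials, stored as lists -/

/-- Concatenation. -/
def append {α : Type} : List α → List α → Timed (List α)
  | [], w => do tick; pure w
  | a :: v, w => do
    tick
    let r ← append v w
    pure (a :: r)

/-- Remove the polynomial `0`. -/
def dropZeros : List Poly → Timed (List Poly)
  | [] => do tick; pure []
  | [] :: L => do tick; dropZeros L
  | (m :: p) :: L => do
    tick
    let r ← dropZeros L
    pure ((m :: p) :: r)

/-- A finite set of bit strings. -/
inductive Trie where
  | leaf : Trie
  | node (present : Bool) (zero one : Trie) : Trie

/-- Insert a bit string; the first component tells whether it was already present. -/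
def Trie.insert : List Bool → Trie → Timed (Bool × Trie)
  | [], .leaf => do tick; pure (false, .node true .leaf .leaf)
  | [], .node b s t => do tick; pure (b, .node true s t)
  | false :: w, .leaf => do
    tick
    let (r, s) ← Trie.insert w .leaf
    pure (r, .node false s .leaf)
  | true :: w, .leaf => do
    tick
    let (r, t) ← Trie.insert w .leaf
    pure (r, .node false .leaf t)
  | false :: w, .node b s t => do
    tick
    let (r, s') ← Trie.insert w s
    pure (r, .node b s' t)
  | true :: w, .node b s t => do
    tick
    let (r, t') ← Trie.insert w t
    pure (r, .node b s t')

/-- A polynomial as one self-delimiting bit string. -/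
def bitString : Poly → Timed (List Bool)
  | [] => do tick; pure [false]
  | m :: p => do
    tick
    let w ← bitString p
    let v ← append m w
    pure (true :: v)

/-- Remove repetitions; the trie holds the polynomials met before. -/
def removeDup : Trie → List Poly → Timed (List Poly)
  | _, [] => do tick; pure []
  | T, p :: L => do
    tick
    let w ← bitString p
    let (old, T') ← T.insert w
    let r ← removeDup T' L
    if old then pure r else pure (p :: r)

/-- Does the polynomial `1` occur? -/
def hasOne : List Poly → Timed Bool
  | [] => do tick; pure false
  | p :: L => do
    tick
    if ← isOne p then pure true else hasOne L

/-- Position of the highest leading variable; `none` if all polynomials are constant. -/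
def topPos : List Poly → Timed (Option ℕ)
  | [] => do tick; pure none
  | p :: L => do
    tick
    let a ← leadPos p
    let b ← topPos L
    match a, b with
    | none, b => pure b
    | some i, none => pure (some i)
    | some i, some j => do
      if ← leU i j then pure (some i) else pure (some j)

/-- When `j` is the highest leading position: the polynomials that have it, and the others. -/
def selectTop (j : ℕ) : List Poly → Timed (List Poly × List Poly)
  | [] => do tick; pure ([], [])
  | p :: L => do
    tick
    let a ← leadPos p
    let (PS₁, QS₁) ← selectTop j L
    match a with
    | none => pure (PS₁, p :: QS₁)
    | some i => do
      if ← leU i j then pure (p :: PS₁, QS₁) else pure (PS₁, p :: QS₁)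

/-! ## The algorithm -/

/-- A polynomial system in the output: the union of finitely many (shared) lists. -/
abbrev System := List (List Poly)

/-- The inner loop.  Each `P = I x + U` in `PS₁` is taken out of `PS₁`, the system
`PS₁ ∪ QS₁ ∪ PS₂ ∪ 𝒜 ∪ {I, U}` is recorded, `x + U` is put into `PS₂`, and `I + 1` into `QS₁`. -/
def makeMonic (n j : ℕ) (A : List Poly) :
    (PS₁ QS₁ PS₂ : List Poly) → List System → Timed (List Poly × List Poly × List System)
  | [], QS₁, PS₂, S => do tick; pure (QS₁, PS₂, S)
  | P :: PS₁, QS₁, PS₂, S => do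
    tick
    let (I, U) ← split j P
    let QS₂ : System := [PS₁, QS₁, PS₂, A, [I, U]]
    let x ← varMono n j
    let Q ← add [x] U
    let e ← oneMono n
    let J ← add I [e]
    makeMonic n j A PS₁ (J :: QS₁) (Q :: PS₂) (QS₂ :: S)

/-- The first polynomial of lowest total degree in a list, `Q` (of degree `d`) coming first. -/
def lowestFrom : Poly → ℕ → List Poly → Timed Poly
  | Q, _, [] => do tick; pure Q
  | Q, d, P :: L => do
    tick
    let d' ← deg P
    if ← leU d d' then lowestFrom Q d L else lowestFrom P d' L

/-- The first polynomial of lowest total degree in a nonempty list. -/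
def lowest : List Poly → Timed Poly
  | [] => do tick; pure []
  | Q :: L => do
    tick
    let d ← deg Q
    lowestFrom Q d L

/-- The nonzero pseudo-remainders of the polynomials of a list with respect to `Q`.  All of them
have the form `x + U` with the same variable `x` as `Q = x + V`, so that the pseudo-remainder is
`U + V`, the sum of the two polynomials. -/
def remainders (Q : Poly) : List Poly → Timed (List Poly)
  | [] => do tick; pure []
  | P :: L => do
    tick
    let R ← add P Q
    let r ← remainders Q L
    match R with
    | [] => pure r
    | m :: p => pure ((m :: p) :: r)

/-- A rule for the two choices that the algorithm leaves open: the order in which the polynomials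
of `PS₁` are taken, and which polynomial of lowest degree of `PS₂` is taken (the first one in the
order that the rule puts them in).  Any rule is allowed. -/
structure ChoiceRule where
  order₁ : List Poly → List Poly
  perm₁ : ∀ L, (order₁ L).Perm L
  order₂ : List Poly → List Poly
  perm₂ : ∀ L, (order₂ L).Perm L

structure State where
  PS : List Poly
  A : List Poly
  PSstar : List System

structure Output where
  A : List Poly
  PSstar : List System

/-- One pass through the main loop: either the state for the next pass or the output. -/
def round (n : ℕ) (ρ : ChoiceRule) (s : State) : Timed (State ⊕ Output) := do
  tick
  let PS₀ ← dropZeros s.PS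
  let PS ← removeDup .leaf PS₀
  if ← hasOne PS then pure (.inr ⟨[], s.PSstar⟩) else
    match ← topPos PS with
    | none => pure (.inr ⟨s.A, s.PSstar⟩) -- here `PS` is empty
    | some j => do
      let (PS₁, QS) ← selectTop j PS
      let (QS₁, PS₂, S) ← makeMonic n j s.A (ρ.order₁ PS₁) QS [] s.PSstar
      let Q ← lowest (ρ.order₂ PS₂)
      let R ← remainders Q PS₂
      let PS' ← append QS₁ R
      pure (.inl ⟨PS', Q :: s.A, S⟩)

/-- `Runs n ρ s o t`: started in state `s`, the main loop halts with output `o` after exactly `t`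
elementary steps. -/
inductive Runs (n : ℕ) (ρ : ChoiceRule) : State → Output → ℕ → Prop
  | halt (s : State) (o : Output) (h : (round n ρ s).val = .inr o) :
      Runs n ρ s o (round n ρ s).time
  | next (s s' : State) (o : Output) (t : ℕ) (h : (round n ρ s).val = .inl s')
      (h' : Runs n ρ s' o t) : Runs n ρ s o ((round n ρ s).time + t)

/-- The initial state for the polynomials of the list `L`. -/
noncomputable def start {n : ℕ} (L : List (MvPolynomial (Fin n) (ZMod 2))) : State :=
  ⟨L.map encode, [], []⟩

/-- `L` lists, without repetition, the finite set `PS` of Boolean polynomials in `n` variables.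
Boolean polynomials are taken in canonical form, of degree at most one in each variable. -/
def IsInput {n : ℕ} (PS : Finset (MvPolynomial (Fin n) (ZMod 2)))
    (L : List (MvPolynomial (Fin n) (ZMod 2))) : Prop :=
  (∀ P ∈ PS, P ∈ MvPolynomial.restrictDegree (Fin n) (ZMod 2) 1) ∧
    L.Nodup ∧ ∀ P, P ∈ L ↔ P ∈ PS

/-- The number of terms of a polynomial. -/
def term {n : ℕ} (P : MvPolynomial (Fin n) (ZMod 2)) : ℕ := P.support.card

/-- The number of bits of the input, each polynomial being written as one self-delimiting string:
`n + 1` bits for each monomial and one bit to end the polynomial. -/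
def inputSize {n : ℕ} (PS : Finset (MvPolynomial (Fin n) (ZMod 2))) : ℕ :=
  ∑ P ∈ PS, (term P * (n + 1) + 1)

end MFTri

namespace MFTri

/-! ## Results and running times of the basic routines -/

/-! The cost of a pass is linear in the number of polynomials present and in their length, up to a
factor `n + 1` for the bits of a monomial. There are at most `n + 1` passes, since each pass that
does not halt eliminates its highest variable for good. So it suffices to bound the number of
polynomials and the number of their terms throughout the run.

Number of polynomials. Give a polynomial of degree `e`, when `c` variables are left, the weight
`potential c e`, the number of subsets of a `c`-set with fewer than `e` elements. Eliminating `x`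
from `P = I x + U` of degree `e + 1` leaves `I + 1`, of degree at most `e`, and a remainder of
degree at most `e + 1`; the latter holds because the pivot `Q` has lowest degree. Pascal's rule
`potential_succ` says that the two new weights together do not exceed the old one, so the total
weight never grows. A nonconstant polynomial weighs at least one, and constants are discarded or end
the run at the start of a pass. Hence each pass eliminates from at most `w` polynomials, where `w`
is the initial weight, and produces at most `2 * w`. Since `potential n (e + 1) ≤ 2 * n ^ e`, this
is of order `l * n ^ (d - 1)` for `d ≥ 1`.

Number of terms. Pseudo-remainders could be expected to double the terms at each pass. They do not:
all polynomials of a pass are reduced by the same pivot, and passing to an initial only deletes a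
variable from monomials. So after eliminating the first `k` positions, the monomials of any
polynomial are obtained by `clear k` from `1` and from the monomials of one source input and of at
most `k` pivot inputs common to all polynomials. The map `clear k` cannot increase the number of
monomials, and cancellation only helps (`Below.length_le`).

`Inv` combines both bounds, `Inv.eliminate` shows that they persist, `Inv.round` prices a pass, and
`exists_runs_of_inv` adds up the passes. -/

@[simp] theorem val_bind {α β : Type} (x : Timed α) (f : α → Timed β) :
    (x >>= f).val = (f x.val).val := rfl

@[simp] theorem time_bind {α β : Type} (x : Timed α) (f : α → Timed β) :
    (x >>= f).time = x.time + (f x.val).time := rfl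

@[simp] theorem val_pure {α : Type} (a : α) : (pure a : Timed α).val = a := rfl

@[simp] theorem time_pure {α : Type} (a : α) : (pure a : Timed α).time = 0 := rfl

@[simp] theorem time_tick : tick.time = 1 := rfl

/-! ### Setting leading exponents to zero -/

/-- The monomial obtained by setting the first `k` exponents to zero. -/
def clear : ℕ → Mono → Mono
  | 0, m => m
  | _ + 1, [] => []
  | k + 1, _ :: m => false :: clear k m

@[simp] theorem clear_zero (m : Mono) : clear 0 m = m := by cases m <;> rfl

@[simp] theorem clear_nil (k : ℕ) : clear k [] = [] := by cases k <;> rfl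

@[simp] theorem clear_succ_cons (k : ℕ) (b : Bool) (m : Mono) :
    clear (k + 1) (b :: m) = false :: clear k m := rfl

@[simp] theorem length_clear (k : ℕ) (m : Mono) : (clear k m).length = m.length := by
  induction m generalizing k with
  | nil => simp
  | cons b m ih => cases k <;> simp [ih]

theorem clear_clear {j k : ℕ} (h : k ≤ j) (m : Mono) : clear j (clear k m) = clear j m := by
  induction m generalizing j k with
  | nil => simp
  | cons b m ih =>
    cases k with
    | zero => simp
    | succ k =>
      obtain ⟨j, rfl⟩ : ∃ i, j = i + 1 := ⟨j - 1, by omega⟩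
      simp [ih (show k ≤ j by omega)]

theorem clear_eq_of_le {j k : ℕ} (h : k ≤ j) {m : Mono} (hm : clear j m = m) :
    clear k m = m := by
  induction m generalizing j k with
  | nil => simp
  | cons b m ih =>
    cases k with
    | zero => simp
    | succ k =>
      obtain ⟨j, rfl⟩ : ∃ i, j = i + 1 := ⟨j - 1, by omega⟩
      simp only [clear_succ_cons, List.cons.injEq] at hm ⊢
      exact ⟨hm.1, ih (show k ≤ j by omega) hm.2⟩

/-- Leading zeros of a monomial are inherited by every lexicographically smaller one. Hence the
first monomial of a stored polynomial determines its leading variable. -/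
theorem clear_eq_of_le_mono {j : ℕ} {m m' : Mono} (hl : m'.length = m.length) (h : m' ≤ m)
    (hm : clear j m = m) : clear j m' = m' := by
  induction m generalizing j m' with
  | nil => simp_all
  | cons b m ih =>
    cases m' with
    | nil => simp
    | cons b' m' =>
      cases j with
      | zero => simp
      | succ j =>
        simp only [clear_succ_cons, List.cons.injEq] at hm ⊢
        obtain ⟨rfl, hm⟩ := hm
        have : b' = false ∧ m' ≤ m := by
          rcases h.lt_or_eq with h | h
          · rw [List.cons_lt_cons_iff] at h
            rcases h with h | ⟨h, h'⟩
            · exact absurd h (by simp)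
            · exact ⟨h, h'.le⟩
          · simp only [List.cons.injEq] at h
            exact ⟨h.1, h.2.le⟩
        exact ⟨this.1.symm, ih (by simpa using hl) this.2 hm⟩

theorem clear_eq_of_count_eq_zero {m : Mono} (h : m.count true = 0) (k : ℕ) : clear k m = m := by
  induction m generalizing k with
  | nil => simp
  | cons b m ih =>
    cases k with
    | zero => simp
    | succ k => cases b <;> simp_all

theorem clear_replicate (k n : ℕ) :
    clear k (List.replicate n false) = List.replicate n false :=
  clear_eq_of_count_eq_zero (by simp [List.count_replicate]) k

/-! ### Comparison of monomials and addition of polynomials -/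

theorem cmpMono_spec (m m' : Mono) (h : m.length = m'.length) :
    ((cmpMono m m').val = .gt ∧ m' < m) ∨ ((cmpMono m m').val = .lt ∧ m < m') ∨
      ((cmpMono m m').val = .eq ∧ m = m') := by
  induction m generalizing m' with
  | nil =>
    cases m' with
    | nil => right; right; exact ⟨rfl, rfl⟩
    | cons => simp at h
  | cons b m ih =>
    cases m' with
    | nil => simp at h
    | cons b' m' =>
      have := ih m' (by simpa using h)
      cases b <;> cases b' <;> simp [cmpMono, List.cons_lt_cons_iff] <;> simpa using this

theorem time_cmpMono_le (m m' : Mono) : (cmpMono m m').time ≤ m.length + 1 := by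
  induction m generalizing m' with
  | nil => simp [cmpMono]
  | cons b m ih =>
    cases m' with
    | nil => cases b <;> simp [cmpMono]
    | cons b' m' =>
      have := ih m'
      cases b <;> cases b' <;> simp [cmpMono] <;> omega

/-- A stored polynomial in `n` variables: a strictly decreasing list of monomials. -/
def Valid (n : ℕ) (p : Poly) : Prop := p.Pairwise (· > ·) ∧ ∀ m ∈ p, m.length = n

theorem Valid.tail {n : ℕ} {m : Mono} {p : Poly} (h : Valid n (m :: p)) : Valid n p :=
  ⟨h.1.of_cons, fun a ha => h.2 a (List.mem_cons_of_mem _ ha)⟩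

theorem Valid.sublist {n : ℕ} {p q : Poly} (h : Valid n p) (hq : q.Sublist p) : Valid n q :=
  ⟨h.1.sublist hq, fun a ha => h.2 a (hq.subset ha)⟩

theorem Valid.head_length {n : ℕ} {m : Mono} {p : Poly} (h : Valid n (m :: p)) : m.length = n :=
  h.2 m List.mem_cons_self

theorem valid_singleton {n : ℕ} {m : Mono} (h : m.length = n) : Valid n [m] :=
  ⟨by simp, by simpa using h⟩

theorem add_nil_left (q : Poly) : (add [] q).val = q := by rw [add]; rfl

theorem add_nil_right (p : Poly) : (add p []).val = p := by cases p <;> rw [add] <;> rfl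

/-- Merging keeps the order and creates no monomial. Every call consumes at least one list cell and
makes at most one comparison of cost `n + 1`, which gives the factor `n + 2`. -/
theorem add_spec {n : ℕ} : ∀ p q : Poly, Valid n p → Valid n q →
    Valid n (add p q).val ∧ (∀ m ∈ (add p q).val, m ∈ p ∨ m ∈ q) ∧
      (add p q).time ≤ (n + 2) * (p.length + q.length + 1)
  | [], q, _, hq => by
    rw [add]
    exact ⟨hq, fun m hm => .inr hm, by simp; nlinarith⟩
  | m :: p, [], hp, _ => by
    rw [add]
    exact ⟨hp, fun m hm => .inl hm, by simp; nlinarith⟩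
  | m :: p, m' :: q, hp, hq => by
    have hl := hp.head_length
    have ht := time_cmpMono_le m m'
    rw [hl] at ht
    rcases cmpMono_spec m m' (by rw [hp.head_length, hq.head_length]) with h | h | h
    · obtain ⟨h1, h2, h3⟩ := add_spec p (m' :: q) hp.tail hq
      have e : (add (m :: p) (m' :: q)).val = m :: (add p (m' :: q)).val := by
        rw [add]; simp [h.1]
      refine ⟨?_, ?_, ?_⟩
      · rw [e]
        refine ⟨List.pairwise_cons.2 ⟨fun a ha => ?_, h1.1⟩, ?_⟩
        · rcases h2 a ha with ha | ha
          · exact (List.pairwise_cons.1 hp.1).1 a ha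
          · rcases List.mem_cons.1 ha with rfl | ha
            · exact h.2
            · exact lt_trans ((List.pairwise_cons.1 hq.1).1 a ha) h.2
        · intro a ha
          rcases List.mem_cons.1 ha with rfl | ha
          · exact hl
          · exact h1.2 a ha
      · rw [e]
        intro a ha
        rcases List.mem_cons.1 ha with rfl | ha
        · simp
        · rcases h2 a ha with ha | ha
          · simp [ha]
          · exact .inr ha
      · rw [add]
        simp only [time_bind, time_tick, h.1, time_pure, List.length_cons] at h3 ⊢
        nlinarith
    · obtain ⟨h1, h2, h3⟩ := add_spec (m :: p) q hp hq.tail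
      have e : (add (m :: p) (m' :: q)).val = m' :: (add (m :: p) q).val := by
        rw [add]; simp [h.1]
      refine ⟨?_, ?_, ?_⟩
      · rw [e]
        refine ⟨List.pairwise_cons.2 ⟨fun a ha => ?_, h1.1⟩, ?_⟩
        · rcases h2 a ha with ha | ha
          · rcases List.mem_cons.1 ha with rfl | ha
            · exact h.2
            · exact lt_trans ((List.pairwise_cons.1 hp.1).1 a ha) h.2
          · exact (List.pairwise_cons.1 hq.1).1 a ha
        · intro a ha
          rcases List.mem_cons.1 ha with rfl | ha
          · exact hq.head_length
          · exact h1.2 a ha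
      · rw [e]
        intro a ha
        rcases List.mem_cons.1 ha with rfl | ha
        · simp
        · rcases h2 a ha with ha | ha
          · exact .inl ha
          · simp [ha]
      · rw [add]
        simp only [time_bind, time_tick, h.1, time_pure, List.length_cons] at h3 ⊢
        nlinarith
    · obtain ⟨h1, h2, h3⟩ := add_spec p q hp.tail hq.tail
      have e : (add (m :: p) (m' :: q)).val = (add p q).val := by
        rw [add]; simp [h.1]
      refine ⟨e ▸ h1, ?_, ?_⟩
      · rw [e]
        intro a ha
        rcases h2 a ha with ha | ha <;> simp [ha]
      · rw [add]
        simp only [time_bind, time_tick, h.1, List.length_cons] at h3 ⊢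
        nlinarith
termination_by p q => p.length + q.length

theorem add_cons_self (m : Mono) (p q : Poly) :
    (add (m :: p) (m :: q)).val = (add p q).val := by
  rw [add]
  rcases cmpMono_spec m m rfl with h | h | h
  · exact absurd h.2 (lt_irrefl _)
  · exact absurd h.2 (lt_irrefl _)
  · simp [h.1]

theorem add_singleton_left {m : Mono} {q : Poly} (h : ∀ a ∈ q, a < m ∧ a.length = m.length) :
    (add [m] q).val = m :: q := by
  cases q with
  | nil => exact add_nil_right _
  | cons a q =>
    obtain ⟨h1, h2⟩ := h a List.mem_cons_self
    rw [add]
    rcases cmpMono_spec m a h2.symm with h | h | h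
    · simp [h.1, add_nil_left]
    · exact absurd h.2 (lt_asymm h1)
    · exact absurd h.2 (ne_of_gt h1)

/-! ### Splitting -/

/-- Whether the variable in position `j` divides the monomial. -/
def hasVar (j : ℕ) (m : Mono) : Bool := (eraseVar j m).val.1

/-- When nothing above position `j` occurs, deleting that variable is the same as clearing the first
`j + 1` exponents. In this way initials stay within the images of input monomials under `clear`. -/
theorem eraseVar_spec (j : ℕ) (m : Mono) (h : clear j m = m) :
    (eraseVar j m).val.2 = clear (j + 1) m := by
  induction m generalizing j with
  | nil => simp [eraseVar]
  | cons b m ih =>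
    cases j with
    | zero => simp [eraseVar]
    | succ j =>
      simp only [clear_succ_cons, List.cons.injEq] at h
      simp [eraseVar, ih j h.2, h.1]

theorem clear_succ_eq_of_not_hasVar {j : ℕ} {m : Mono} (h : clear j m = m)
    (hv : hasVar j m = false) : clear (j + 1) m = m := by
  induction m generalizing j with
  | nil => simp
  | cons b m ih =>
    cases j with
    | zero => simpa [hasVar, eraseVar, eq_comm] using hv
    | succ j =>
      simp only [clear_succ_cons, List.cons.injEq] at h
      simp only [clear_succ_cons, List.cons.injEq]
      exact ⟨h.1, ih h.2 (by simpa [hasVar, eraseVar] using hv)⟩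

theorem count_clear_succ {j : ℕ} {m : Mono} (hv : hasVar j m = true) :
    (clear (j + 1) m).count true + 1 ≤ m.count true := by
  induction m generalizing j with
  | nil => simp [hasVar, eraseVar] at hv
  | cons b m ih =>
    cases j with
    | zero =>
      obtain rfl : b = true := by simpa [hasVar, eraseVar] using hv
      simp
    | succ j =>
      have := ih (j := j) (by simpa [hasVar, eraseVar] using hv)
      cases b <;> simp <;> omega

/-- Both monomials start with the same `j` zeros followed by a one, so the comparison is decided by
the remaining exponents. It follows that the initial is sorted as it stands, without cancellation.
-/
theorem clear_succ_lt {j : ℕ} {m m' : Mono} (h : m' < m) (hm : clear j m = m)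
    (hm' : clear j m' = m') (hv : hasVar j m = true) (hv' : hasVar j m' = true) :
    clear (j + 1) m' < clear (j + 1) m := by
  induction m generalizing j m' with
  | nil => simp [hasVar, eraseVar] at hv
  | cons b m ih =>
    cases m' with
    | nil => simp [hasVar, eraseVar] at hv'
    | cons b' m' =>
      cases j with
      | zero =>
        obtain rfl : b = true := by simpa [hasVar, eraseVar] using hv
        obtain rfl : b' = true := by simpa [hasVar, eraseVar] using hv'
        simpa [List.cons_lt_cons_iff] using h
      | succ j =>
        simp only [clear_succ_cons, List.cons.injEq] at hm hm'
        obtain ⟨rfl, hm⟩ := hm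
        obtain ⟨rfl, hm'⟩ := hm'
        have h : m' < m := by simpa [List.cons_lt_cons_iff] using h
        have := ih h hm hm' (by simpa [hasVar, eraseVar] using hv)
          (by simpa [hasVar, eraseVar] using hv')
        simpa [List.cons_lt_cons_iff] using this

theorem time_eraseVar_le (j : ℕ) (m : Mono) : (eraseVar j m).time ≤ m.length + 1 := by
  induction m generalizing j with
  | nil => simp [eraseVar]
  | cons b m ih =>
    cases j with
    | zero => simp [eraseVar]
    | succ j =>
      have := ih j
      simp [eraseVar]
      omega

theorem time_split_le {n : ℕ} (j : ℕ) (p : Poly) (h : ∀ m ∈ p, m.length = n) :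
    (split j p).time ≤ (n + 2) * p.length + 1 := by
  induction p with
  | nil => simp [split]
  | cons m p ih =>
    have h1 := ih fun a ha => h a (List.mem_cons_of_mem _ ha)
    have h2 := time_eraseVar_le j m
    rw [h m List.mem_cons_self] at h2
    have : (split j (m :: p)).time = 1 + ((eraseVar j m).time + (split j p).time) := by
      simp only [split, time_bind, time_tick]
      split <;> simp
    rw [this, List.length_cons]
    nlinarith

theorem split_val {j : ℕ} {p : Poly} (h : ∀ m ∈ p, clear j m = m) :
    (split j p).val = ((p.filter (hasVar j)).map (clear (j + 1)),
      p.filter (fun m => !hasVar j m)) := by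
  induction p with
  | nil => rfl
  | cons m p ih =>
    have h1 := ih fun a ha => h a (List.mem_cons_of_mem _ ha)
    have h2 := eraseVar_spec j m (h m List.mem_cons_self)
    have h3 : (split j (m :: p)).val = if hasVar j m = true
        then ((eraseVar j m).val.2 :: (split j p).val.1, (split j p).val.2)
        else ((split j p).val.1, (eraseVar j m).val.2 :: (split j p).val.2) := by
      simp only [split, val_bind]
      split <;> simp_all [hasVar]
    rw [h3, h1, h2]
    cases hv : hasVar j m
    · simp [hv, clear_succ_eq_of_not_hasVar (h m List.mem_cons_self) hv]
    · simp [hv]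

/-! ### Leading variables and degrees -/

theorem leadMono_none {m : Mono} (h : (leadMono m).val = none) : m.count true = 0 := by
  induction m with
  | nil => rfl
  | cons b m ih =>
    cases b
    · have : (leadMono m).val = none := by simpa [leadMono] using h
      simpa using ih this
    · simp [leadMono] at h

theorem leadMono_some {m : Mono} {i : ℕ} (h : (leadMono m).val = some i) :
    clear i m = m ∧ hasVar i m = true ∧ i < m.length := by
  induction m generalizing i with
  | nil => simp [leadMono] at h
  | cons b m ih =>
    cases b
    · have : ∃ a, (leadMono m).val = some a ∧ a + 1 = i := by simpa [leadMono] using h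
      obtain ⟨a, ha, rfl⟩ := this
      obtain ⟨h1, h2, h3⟩ := ih ha
      refine ⟨by simp [h1], by simpa [hasVar, eraseVar] using h2, by simpa using h3⟩
    · obtain rfl : 0 = i := by simpa [leadMono] using h
      simp [hasVar, eraseVar]

theorem hasVar_eq_false {j i : ℕ} (h : j < i) {m : Mono} (hm : clear i m = m) :
    hasVar j m = false := by
  induction m generalizing i j with
  | nil => simp [hasVar, eraseVar]
  | cons b m ih =>
    obtain ⟨i, rfl⟩ : ∃ a, i = a + 1 := ⟨i - 1, by omega⟩
    simp only [clear_succ_cons, List.cons.injEq] at hm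
    cases j with
    | zero => simpa [hasVar, eraseVar, eq_comm] using hm.1
    | succ j => simpa [hasVar, eraseVar] using ih (show j < i by omega) hm.2

theorem time_leadMono_le (m : Mono) : (leadMono m).time ≤ m.length + 1 := by
  induction m with
  | nil => simp [leadMono]
  | cons b m ih => cases b <;> simp [leadMono]; omega

theorem time_leadPos_le {n : ℕ} {p : Poly} (h : Valid n p) : (leadPos p).time ≤ n + 2 := by
  cases p with
  | nil => simp [leadPos]
  | cons m p =>
    have := time_leadMono_le m
    rw [h.head_length] at this
    simp [leadPos]
    omega

theorem clear_eq_of_leadPos {n : ℕ} {p : Poly} {i : ℕ} (h : Valid n p)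
    (hi : (leadPos p).val = some i) : i < n ∧ ∀ m ∈ p, clear i m = m := by
  cases p with
  | nil => simp [leadPos] at hi
  | cons m p =>
    obtain ⟨h1, h2, h3⟩ := leadMono_some (m := m) (i := i) (by simpa [leadPos] using hi)
    rw [h.head_length] at h3
    refine ⟨h3, fun a ha => ?_⟩
    rcases List.mem_cons.1 ha with rfl | ha
    · exact h1
    · exact clear_eq_of_le_mono (by rw [h.head_length, h.tail.2 a ha])
        (le_of_lt ((List.pairwise_cons.1 h.1).1 a ha)) h1

theorem le_of_leadPos {p : Poly} {i k : ℕ} (hi : (leadPos p).val = some i)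
    (hk : ∀ m ∈ p, clear k m = m) : k ≤ i := by
  cases p with
  | nil => simp [leadPos] at hi
  | cons m p =>
    obtain ⟨h1, h2, h3⟩ := leadMono_some (m := m) (i := i) (by simpa [leadPos] using hi)
    by_contra! hlt
    rw [hasVar_eq_false hlt (hk m List.mem_cons_self)] at h2
    simp at h2

theorem leU_val (a b : ℕ) : (leU a b).val = decide (a ≤ b) := by
  induction a generalizing b with
  | zero => simp [leU]
  | succ a ih => cases b <;> simp [leU, ih]

theorem time_leU_le (a b : ℕ) : (leU a b).time ≤ a + 1 := by
  induction a generalizing b with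
  | zero => simp [leU]
  | succ a ih =>
    cases b with
    | zero => simp [leU]
    | succ b =>
      have := ih b
      simp [leU]
      omega

theorem degMono_val (m : Mono) : (degMono m).val = m.count true := by
  induction m with
  | nil => rfl
  | cons b m ih => cases b <;> simp [degMono, ih]

theorem time_degMono (m : Mono) : (degMono m).time = m.length + 1 := by
  induction m with
  | nil => rfl
  | cons b m ih =>
    simp [degMono, ih]
    omega

theorem deg_val_cons (m : Mono) (p : Poly) :
    (deg (m :: p)).val = max (m.count true) (deg p).val := by
  simp only [deg, val_bind, degMono_val, leU_val]
  by_cases h : m.count true ≤ (deg p).val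
  · simp [h]
  · simp [h]
    omega

theorem deg_val_le_iff {p : Poly} {e : ℕ} :
    (deg p).val ≤ e ↔ ∀ m ∈ p, m.count true ≤ e := by
  induction p with
  | nil => simp [deg]
  | cons m p ih => rw [deg_val_cons, max_le_iff, ih]; simp

theorem count_le_deg {p : Poly} {m : Mono} (h : m ∈ p) : m.count true ≤ (deg p).val :=
  deg_val_le_iff.1 le_rfl m h

theorem deg_le {n : ℕ} {p : Poly} (h : Valid n p) : (deg p).val ≤ n :=
  deg_val_le_iff.2 fun m hm => (List.count_le_length).trans (h.2 m hm).le

theorem time_deg_le {n : ℕ} {p : Poly} (h : ∀ m ∈ p, m.length = n) :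
    (deg p).time ≤ (2 * n + 3) * p.length + 1 := by
  induction p with
  | nil => simp [deg]
  | cons m p ih =>
    have h1 := ih fun a ha => h a (List.mem_cons_of_mem _ ha)
    have h2 := time_leU_le (m.count true) (deg p).val
    have h3 : m.count true ≤ n := (List.count_le_length).trans (h m List.mem_cons_self).le
    have : (deg (m :: p)).time
        = 1 + ((degMono m).time + ((deg p).time + (leU (m.count true) (deg p).val).time)) := by
      simp only [deg, time_bind, time_tick, degMono_val]
      split <;> simp
    rw [this, time_degMono, h m List.mem_cons_self, List.length_cons]
    nlinarith

/-! ### The monomial `1` and the single variables -/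

theorem oneMono_val (n : ℕ) : (oneMono n).val = List.replicate n false := by
  induction n with
  | zero => rfl
  | succ n ih => simp [oneMono, ih, List.replicate_succ]

theorem time_oneMono (n : ℕ) : (oneMono n).time = n + 1 := by
  induction n with
  | zero => rfl
  | succ n ih =>
    simp [oneMono, ih]
    omega

theorem time_varMono_le (n j : ℕ) : (varMono n j).time ≤ n + 1 := by
  induction n generalizing j with
  | zero => simp [varMono]
  | succ n ih =>
    cases j with
    | zero => simp [varMono, time_oneMono]; omega
    | succ j =>
      have := ih j
      simp [varMono]
      omega

theorem length_varMono (n j : ℕ) : (varMono n j).val.length = n := by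
  induction n generalizing j with
  | zero => simp [varMono]
  | succ n ih => cases j <;> simp [varMono, oneMono_val, ih]

theorem count_varMono_le (n j : ℕ) : (varMono n j).val.count true ≤ 1 := by
  induction n generalizing j with
  | zero => simp [varMono]
  | succ n ih =>
    cases j <;> simp [varMono, oneMono_val, List.count_replicate, ih]

theorem lt_varMono {n j : ℕ} (hj : j < n) {m : Mono} (hm : clear (j + 1) m = m)
    (hl : m.length = n) : m < (varMono n j).val := by
  induction n generalizing j m with
  | zero => omega
  | succ n ih =>
    cases m with
    | nil => simp at hl
    | cons b m =>
      simp only [clear_succ_cons, List.cons.injEq] at hm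
      obtain ⟨rfl, hm⟩ := hm
      cases j with
      | zero => simp [varMono, List.cons_lt_cons_iff]
      | succ j =>
        have := ih (show j < n by omega) hm (by simpa using hl)
        simpa [varMono, List.cons_lt_cons_iff] using this

theorem time_isOne_le {n : ℕ} {p : Poly} (h : Valid n p) : (isOne p).time ≤ n + 2 := by
  match p with
  | [] => simp [isOne]
  | [m] =>
    have h1 := time_leadMono_le m
    rw [h.head_length] at h1
    have : (isOne [m]).time = 1 + (leadMono m).time := by
      simp only [isOne, time_bind, time_tick]
      split <;> simp
    omega
  | _ :: _ :: _ => simp [isOne]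

/-- If the first monomial is `1`, no smaller monomial can follow it, so the polynomial is `1`
itself. Thus once zeros are dropped and the test for `1` has failed, only nonconstant polynomials
remain. -/
theorem leadPos_ne_none {n : ℕ} {p : Poly} (h : Valid n p) (h0 : p ≠ [])
    (h1 : (isOne p).val = false) : (leadPos p).val ≠ none := by
  intro hn
  match p with
  | [] => exact h0 rfl
  | [m] =>
    have : (leadMono m).val = none := by simpa [leadPos] using hn
    simp [isOne, this] at h1
  | m :: a :: p =>
    have hm : m.count true = 0 := leadMono_none (by simpa [leadPos] using hn)
    have hlt : a < m := (List.pairwise_cons.1 h.1).1 a List.mem_cons_self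
    have hla : a.length = n := h.2 a (by simp)
    have e1 : clear n m = m := clear_eq_of_count_eq_zero hm n
    have e2 : clear n a = a := clear_eq_of_le_mono (by rw [hla, h.head_length]) hlt.le e1
    have key : ∀ x : Mono, x.length = n → clear n x = x → x = List.replicate n false := by
      intro x hx hc
      clear * - hx hc
      induction x generalizing n with
      | nil => simp at hx; simp [← hx]
      | cons b x ih =>
        obtain rfl : x.length + 1 = n := by simpa using hx
        simp only [clear_succ_cons, List.cons.injEq] at hc
        rw [List.replicate_succ, ← ih rfl hc.2, ← hc.1]
    rw [key a hla e2, key m h.head_length e1] at hlt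
    exact lt_irrefl _ hlt

/-! ## Results and running times of the routines for lists of polynomials -/

@[simp] theorem append_val {α : Type} (v w : List α) : (append v w).val = v ++ w := by
  induction v with
  | nil => rfl
  | cons a v ih => simp [append, ih]

@[simp] theorem time_append {α : Type} (v w : List α) : (append v w).time = v.length + 1 := by
  induction v with
  | nil => rfl
  | cons a v ih => simp [append, ih]; omega

theorem dropZeros_val (L : List Poly) : (dropZeros L).val = L.filter (· ≠ []) := by
  induction L with
  | nil => rfl
  | cons p L ih => cases p <;> simp [dropZeros, ih]

theorem time_dropZeros (L : List Poly) : (dropZeros L).time = L.length + 1 := by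
  induction L with
  | nil => rfl
  | cons p L ih => cases p <;> simp [dropZeros, ih] <;> omega

theorem time_insert_le (w : List Bool) (T : Trie) : (T.insert w).time ≤ w.length + 1 := by
  induction w generalizing T with
  | nil => cases T <;> simp [Trie.insert]
  | cons b w ih =>
    cases T with
    | leaf =>
      have := ih .leaf
      cases b <;> simp [Trie.insert] <;> omega
    | node c s t =>
      have h1 := ih s
      have h2 := ih t
      cases b <;> simp [Trie.insert] <;> omega

theorem length_bitString {n : ℕ} {p : Poly} (h : ∀ m ∈ p, m.length = n) :
    (bitString p).val.length = (n + 1) * p.length + 1 := by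
  induction p with
  | nil => rfl
  | cons m p ih =>
    have h1 := ih fun a ha => h a (List.mem_cons_of_mem _ ha)
    simp [bitString, h1, h m List.mem_cons_self]
    ring

theorem time_bitString {n : ℕ} {p : Poly} (h : ∀ m ∈ p, m.length = n) :
    (bitString p).time = (n + 2) * p.length + 1 := by
  induction p with
  | nil => rfl
  | cons m p ih =>
    have h1 := ih fun a ha => h a (List.mem_cons_of_mem _ ha)
    simp [bitString, h1, h m List.mem_cons_self]
    ring

/-- This is all that the invariant needs to know about the removal of repetitions. -/
theorem removeDup_sublist (T : Trie) (L : List Poly) : (removeDup T L).val.Sublist L := by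
  induction L generalizing T with
  | nil => simp [removeDup]
  | cons p L ih =>
    simp only [removeDup, val_bind]
    split
    · exact (ih _).cons _
    · exact (ih _).cons_cons _

theorem time_removeDup_le {n B : ℕ} (T : Trie) (L : List Poly)
    (h : ∀ p ∈ L, Valid n p ∧ p.length ≤ B) :
    (removeDup T L).time ≤ 5 * ((n + 1) * (B + 1)) * L.length + 1 := by
  induction L generalizing T with
  | nil => simp [removeDup]
  | cons p L ih =>
    obtain ⟨hp, hB⟩ := h p List.mem_cons_self
    have h1 := ih (T.insert (bitString p).val).val.2 fun a ha => h a (List.mem_cons_of_mem _ ha)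
    have h2 := time_insert_le (bitString p).val T
    have h3 : (removeDup T (p :: L)).time = 1 + ((bitString p).time +
        ((T.insert (bitString p).val).time
          + (removeDup (T.insert (bitString p).val).val.2 L).time)) := by
      simp only [removeDup, time_bind, time_tick]
      split <;> simp
    rw [h3, time_bitString hp.2, List.length_cons]
    rw [length_bitString hp.2] at h2
    nlinarith [Nat.mul_le_mul_left (n + 1) hB]

theorem hasOne_eq_false {L : List Poly} (h : (hasOne L).val = false) :
    ∀ p ∈ L, (isOne p).val = false := by
  induction L with
  | nil => simp
  | cons p L ih =>
    cases hp : (isOne p).val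
    · simp only [hasOne, val_bind, hp] at h
      simpa [hp] using ih h
    · simp [hasOne, hp] at h

theorem time_hasOne_le {n : ℕ} {L : List Poly} (h : ∀ p ∈ L, Valid n p) :
    (hasOne L).time ≤ 3 * (n + 1) * L.length + 1 := by
  induction L with
  | nil => simp [hasOne]
  | cons p L ih =>
    have h1 := ih fun a ha => h a (List.mem_cons_of_mem _ ha)
    have h2 := time_isOne_le (h p List.mem_cons_self)
    have h3 : (hasOne (p :: L)).time ≤ 1 + ((isOne p).time + (hasOne L).time) := by
      simp only [hasOne, time_bind, time_tick]
      split <;> simp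
    rw [List.length_cons]
    nlinarith

theorem topPos_none {L : List Poly} (h : (topPos L).val = none) :
    ∀ p ∈ L, (leadPos p).val = none := by
  induction L with
  | nil => simp
  | cons p L ih =>
    simp only [topPos, val_bind] at h
    cases ha : (leadPos p).val with
    | none =>
      simp only [ha, val_pure] at h
      simpa [ha] using ih h
    | some i =>
      cases hb : (topPos L).val with
      | none => simp [ha, hb] at h
      | some j =>
        simp only [ha, hb, val_bind] at h
        split at h <;> simp at h

theorem topPos_some {L : List Poly} {j : ℕ} (h : (topPos L).val = some j) :
    (∃ p ∈ L, (leadPos p).val = some j) ∧ ∀ p ∈ L, ∀ i, (leadPos p).val = some i → j ≤ i := by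
  induction L generalizing j with
  | nil => simp [topPos] at h
  | cons p L ih =>
    simp only [topPos, val_bind] at h
    cases ha : (leadPos p).val with
    | none =>
      simp only [ha, val_pure] at h
      obtain ⟨⟨q, hq, hq'⟩, h2⟩ := ih h
      refine ⟨⟨q, List.mem_cons_of_mem _ hq, hq'⟩, fun a hmem i hi => ?_⟩
      rcases List.mem_cons.1 hmem with rfl | hmem
      · simp [ha] at hi
      · exact h2 a hmem i hi
    | some i =>
      cases hb : (topPos L).val with
      | none =>
        simp only [ha, hb, val_pure, Option.some.injEq] at h
        subst h
        refine ⟨⟨p, List.mem_cons_self, ha⟩, fun a hmem i' hi => ?_⟩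
        rcases List.mem_cons.1 hmem with rfl | hmem
        · rw [ha] at hi
          exact (Option.some.inj hi).le
        · simp [topPos_none hb a hmem] at hi
      | some j' =>
        obtain ⟨⟨q, hq, hq'⟩, h2⟩ := ih hb
        simp only [ha, hb, val_bind, leU_val] at h
        by_cases hij : i ≤ j'
        · simp only [hij, decide_true, if_true, val_pure, Option.some.injEq] at h
          subst h
          refine ⟨⟨p, List.mem_cons_self, ha⟩, fun a hmem i' hi => ?_⟩
          rcases List.mem_cons.1 hmem with rfl | hmem
          · rw [ha] at hi
            exact (Option.some.inj hi).le
          · exact hij.trans (h2 a hmem i' hi)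
        · simp only [hij, decide_false, Bool.false_eq_true, if_false, val_pure,
            Option.some.injEq] at h
          subst h
          refine ⟨⟨q, List.mem_cons_of_mem _ hq, hq'⟩, fun a hmem i' hi => ?_⟩
          rcases List.mem_cons.1 hmem with rfl | hmem
          · rw [ha] at hi
            have := Option.some.inj hi
            omega
          · exact h2 a hmem i' hi

theorem time_topPos_le {n : ℕ} {L : List Poly} (h : ∀ p ∈ L, Valid n p) :
    (topPos L).time ≤ 3 * (n + 1) * L.length + 1 := by
  induction L with
  | nil => simp [topPos]
  | cons p L ih =>
    have h1 := ih fun a ha => h a (List.mem_cons_of_mem _ ha)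
    have hp := h p List.mem_cons_self
    have h2 := time_leadPos_le hp
    have h3 : (topPos (p :: L)).time ≤ 1 + ((leadPos p).time + ((topPos L).time + n)) := by
      simp only [topPos, time_bind, time_tick]
      cases ha : (leadPos p).val with
      | none => simp
      | some i =>
        cases hb : (topPos L).val with
        | none => simp
        | some j =>
          have h4 := time_leU_le i j
          have h5 := (clear_eq_of_leadPos hp ha).1
          simp only [time_bind]
          split <;> simp <;> omega
    rw [List.length_cons]
    nlinarith

theorem selectTop_spec (j : ℕ) (L : List Poly) :
    ((selectTop j L).val.1 ++ (selectTop j L).val.2).Perm L ∧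
      (∀ p ∈ (selectTop j L).val.1, ∃ i ≤ j, (leadPos p).val = some i) ∧
      ∀ p ∈ (selectTop j L).val.2, ∀ i, (leadPos p).val = some i → j < i := by
  induction L with
  | nil => simp [selectTop]
  | cons p L ih =>
    obtain ⟨h1, h2, h3⟩ := ih
    have hr : ((selectTop j L).val.1 ++ p :: (selectTop j L).val.2).Perm (p :: L) :=
      List.perm_middle.trans (h1.cons p)
    simp only [selectTop, val_bind]
    cases ha : (leadPos p).val with
    | none =>
      refine ⟨hr, h2, fun a hmem i hi => ?_⟩
      rcases List.mem_cons.1 hmem with rfl | hmem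
      · simp [ha] at hi
      · exact h3 a hmem i hi
    | some i =>
      simp only [val_bind, leU_val]
      by_cases hij : i ≤ j
      · simp only [hij, decide_true, if_true, val_pure]
        refine ⟨h1.cons p, fun a hmem => ?_, h3⟩
        rcases List.mem_cons.1 hmem with rfl | hmem
        · exact ⟨i, hij, ha⟩
        · exact h2 a hmem
      · simp only [hij, decide_false, Bool.false_eq_true, if_false, val_pure]
        refine ⟨hr, h2, fun a hmem i' hi => ?_⟩
        rcases List.mem_cons.1 hmem with rfl | hmem
        · rw [ha] at hi
          have := Option.some.inj hi
          omega
        · exact h3 a hmem i' hi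

theorem time_selectTop_le {n : ℕ} (j : ℕ) {L : List Poly} (h : ∀ p ∈ L, Valid n p) :
    (selectTop j L).time ≤ 3 * (n + 1) * L.length + 1 := by
  induction L with
  | nil => simp [selectTop]
  | cons p L ih =>
    have h1 := ih fun a ha => h a (List.mem_cons_of_mem _ ha)
    have hp := h p List.mem_cons_self
    have h2 := time_leadPos_le hp
    have h3 : (selectTop j (p :: L)).time
        ≤ 1 + ((leadPos p).time + ((selectTop j L).time + n)) := by
      simp only [selectTop, time_bind, time_tick]
      cases ha : (leadPos p).val with
      | none => simp
      | some i =>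
        have h4 := time_leU_le i j
        have h5 := (clear_eq_of_leadPos hp ha).1
        simp only [time_bind]
        split <;> simp <;> omega
    rw [List.length_cons]
    nlinarith

/-! ### The inner loop -/

/-- The initial of a polynomial with respect to the variable in position `j`. -/
def initial (j : ℕ) (P : Poly) : Poly := (P.filter (hasVar j)).map (clear (j + 1))

/-- The part of a polynomial that is free of the variable in position `j`. -/
def free (j : ℕ) (P : Poly) : Poly := P.filter fun m => !hasVar j m

/-- The polynomial `I + 1` for `P = I x + U`. -/
def initialAddOne (n j : ℕ) (P : Poly) : Poly :=
  (add (initial j P) [List.replicate n false]).val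

/-- The polynomial `x + U` for `P = I x + U`. -/
def monic (n j : ℕ) (P : Poly) : Poly := (varMono n j).val :: free j P

theorem Valid.free {n j : ℕ} {P : Poly} (h : Valid n P) : Valid n (free j P) :=
  h.sublist List.filter_sublist

theorem clear_free {j : ℕ} {P : Poly} (hP : ∀ m ∈ P, clear j m = m) :
    ∀ m ∈ free j P, clear (j + 1) m = m := by
  intro m hm
  obtain ⟨h1, h2⟩ := List.mem_filter.1 hm
  exact clear_succ_eq_of_not_hasVar (hP m h1) (by simpa using h2)

theorem Valid.initial {n j : ℕ} {P : Poly} (h : Valid n P) (hP : ∀ m ∈ P, clear j m = m) :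
    Valid n (initial j P) := by
  constructor
  · refine List.pairwise_map.2 (List.Pairwise.imp_of_mem ?_ (h.1.filter _))
    intro a b ha hb hab
    obtain ⟨ha, ha'⟩ := List.mem_filter.1 ha
    obtain ⟨hb, hb'⟩ := List.mem_filter.1 hb
    exact clear_succ_lt hab (hP a ha) (hP b hb) ha' hb'
  · intro m hm
    obtain ⟨a, ha, rfl⟩ := List.mem_map.1 hm
    rw [length_clear]
    exact h.2 a (List.mem_filter.1 ha).1

theorem valid_one (n : ℕ) : Valid n [List.replicate n false] := valid_singleton (by simp)

theorem Valid.initialAddOne {n j : ℕ} {P : Poly} (h : Valid n P)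
    (hP : ∀ m ∈ P, clear j m = m) : Valid n (initialAddOne n j P) :=
  (add_spec _ _ (h.initial hP) (valid_one n)).1

theorem mem_initialAddOne {n j : ℕ} {P : Poly} (h : Valid n P) (hP : ∀ m ∈ P, clear j m = m)
    {m : Mono} (hm : m ∈ initialAddOne n j P) :
    (∃ a ∈ P, hasVar j a = true ∧ m = clear (j + 1) a) ∨ m = List.replicate n false := by
  rcases (add_spec _ _ (h.initial hP) (valid_one n)).2.1 m hm with hm | hm
  · obtain ⟨a, ha, rfl⟩ := List.mem_map.1 hm
    obtain ⟨h1, h2⟩ := List.mem_filter.1 ha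
    exact .inl ⟨a, h1, h2, rfl⟩
  · exact .inr (by simpa using hm)

/-- The variable exceeds every monomial of `U`, so the merge merely puts it in front. All
polynomials made monic in a pass therefore begin with the same monomial, which cancels in each
pseudo-remainder. -/
theorem add_varMono_free {n j : ℕ} {P : Poly} (hj : j < n) (h : Valid n P)
    (hP : ∀ m ∈ P, clear j m = m) :
    (add [(varMono n j).val] (free j P)).val = monic n j P :=
  add_singleton_left fun a ha =>
    ⟨lt_varMono hj (clear_free hP a ha) (h.free.2 a ha), by rw [h.free.2 a ha, length_varMono]⟩

theorem Valid.monic {n j : ℕ} {P : Poly} (hj : j < n) (h : Valid n P)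
    (hP : ∀ m ∈ P, clear j m = m) : Valid n (monic n j P) := by
  rw [← add_varMono_free hj h hP]
  exact (add_spec _ _ (valid_singleton (length_varMono n j)) h.free).1

theorem makeMonic_val {n j : ℕ} (hj : j < n) (A PS₁ QS PS₂ : List Poly) (S : List System)
    (h : ∀ P ∈ PS₁, Valid n P ∧ ∀ m ∈ P, clear j m = m) :
    (makeMonic n j A PS₁ QS PS₂ S).val.1 = (PS₁.map (initialAddOne n j)).reverse ++ QS ∧
      (makeMonic n j A PS₁ QS PS₂ S).val.2.1 = (PS₁.map (monic n j)).reverse ++ PS₂ := by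
  induction PS₁ generalizing QS PS₂ S with
  | nil => simp [makeMonic]
  | cons P PS₁ ih =>
    obtain ⟨h1, h2⟩ := h P List.mem_cons_self
    have hs := split_val h2
    have hi := fun QS PS₂ S => ih QS PS₂ S fun a ha => h a (List.mem_cons_of_mem _ ha)
    have e1 := add_varMono_free hj h1 h2
    simp only [makeMonic, val_bind, oneMono_val, hi]
    rw [hs]
    refine ⟨by simp [initialAddOne, initial], ?_⟩
    rw [show (List.filter (fun m => !hasVar j m) P) = free j P from rfl, e1]
    simp

theorem time_makeMonic_le {n j B : ℕ} (A PS₁ QS PS₂ : List Poly) (S : List System)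
    (h : ∀ P ∈ PS₁, Valid n P ∧ (∀ m ∈ P, clear j m = m) ∧ P.length ≤ B) :
    (makeMonic n j A PS₁ QS PS₂ S).time
      ≤ 12 * ((n + 1) * (B + 1)) * PS₁.length + 1 := by
  induction PS₁ generalizing QS PS₂ S with
  | nil => simp [makeMonic]
  | cons P PS₁ ih =>
    obtain ⟨h1, h2, h3⟩ := h P List.mem_cons_self
    have hs := split_val h2
    have hi := fun QS PS₂ S => ih QS PS₂ S fun a ha => h a (List.mem_cons_of_mem _ ha)
    have t1 := time_split_le j P h1.2
    have t2 := time_varMono_le n j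
    have t3 := (add_spec _ _ (valid_singleton (length_varMono n j)) (h1.free (j := j))).2.2
    have t4 := (add_spec _ _ (h1.initial h2) (valid_one n)).2.2
    have l1 : (free j P).length ≤ B := (List.length_filter_le _ _).trans h3
    have l2 : (initial j P).length ≤ B := by
      rw [initial, List.length_map]
      exact (List.length_filter_le _ _).trans h3
    simp only [makeMonic, time_bind, time_tick, time_oneMono, oneMono_val]
    rw [hs]
    refine (Nat.add_le_add_left (Nat.add_le_add_left (Nat.add_le_add_left (Nat.add_le_add
      t3 (Nat.add_le_add_left (Nat.add_le_add t4 (hi _ _ _)) _)) _) _) _).trans ?_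
    simp only [List.length_cons, List.length_nil]
    have a1 := Nat.mul_le_mul_left (n + 2) h3
    have a2 := Nat.mul_le_mul_left (n + 2) l1
    have a3 := Nat.mul_le_mul_left (n + 2) l2
    nlinarith

/-! ### The pivot and the pseudo-remainders -/

theorem lowestFrom_spec (L : List Poly) (Q : Poly) :
    (lowestFrom Q (deg Q).val L).val ∈ Q :: L ∧
      ∀ P ∈ Q :: L, (deg (lowestFrom Q (deg Q).val L).val).val ≤ (deg P).val := by
  induction L generalizing Q with
  | nil => simp [lowestFrom]
  | cons P L ih =>
    simp only [lowestFrom, val_bind, leU_val]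
    by_cases hd : (deg Q).val ≤ (deg P).val
    · simp only [hd, decide_true, if_true]
      obtain ⟨h1, h2⟩ := ih Q
      refine ⟨?_, fun a ha => ?_⟩
      · rcases List.mem_cons.1 h1 with h | h
        · rw [h]; exact List.mem_cons_self
        · exact List.mem_cons_of_mem _ (List.mem_cons_of_mem _ h)
      · have h3 := h2 Q List.mem_cons_self
        rcases List.mem_cons.1 ha with rfl | ha
        · exact h3
        · rcases List.mem_cons.1 ha with rfl | ha
          · exact h3.trans hd
          · exact h2 a (List.mem_cons_of_mem _ ha)
    · simp only [hd, decide_false, Bool.false_eq_true, if_false]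
      obtain ⟨h1, h2⟩ := ih P
      refine ⟨List.mem_cons_of_mem _ h1, fun a ha => ?_⟩
      rcases List.mem_cons.1 ha with rfl | ha
      · have := h2 P List.mem_cons_self
        omega
      · exact h2 a ha

theorem lowest_spec {L : List Poly} (h : L ≠ []) :
    (lowest L).val ∈ L ∧ ∀ P ∈ L, (deg (lowest L).val).val ≤ (deg P).val := by
  cases L with
  | nil => exact absurd rfl h
  | cons Q L => exact lowestFrom_spec L Q

/-- The length bound is `B + 1`, not `B`, because `x + U` may have one term more than the polynomial
it was made from. -/
theorem time_lowestFrom_le {n B : ℕ} (L : List Poly) (Q : Poly) (hQ : Valid n Q)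
    (h : ∀ P ∈ L, Valid n P ∧ P.length ≤ B + 1) :
    (lowestFrom Q (deg Q).val L).time ≤ 6 * ((n + 1) * (B + 1)) * L.length + 1 := by
  induction L generalizing Q with
  | nil => simp [lowestFrom]
  | cons P L ih =>
    obtain ⟨hP, hB⟩ := h P List.mem_cons_self
    have t1 := time_deg_le hP.2
    have t2 := time_leU_le (deg Q).val (deg P).val
    have t3 := deg_le hQ
    have hi := fun Q hQ => ih Q hQ fun a ha => h a (List.mem_cons_of_mem _ ha)
    have t4 : (lowestFrom Q (deg Q).val (P :: L)).time ≤ 1 + ((deg P).time +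
        ((leU (deg Q).val (deg P).val).time + (6 * ((n + 1) * (B + 1)) * L.length + 1))) := by
      simp only [lowestFrom, time_bind, time_tick]
      split
      · have := hi Q hQ
        omega
      · have := hi P hP
        omega
    rw [List.length_cons]
    have := Nat.mul_le_mul_left (2 * n + 3) hB
    nlinarith

theorem time_lowest_le {n B : ℕ} (L : List Poly)
    (h : ∀ P ∈ L, Valid n P ∧ P.length ≤ B + 1) :
    (lowest L).time ≤ 6 * ((n + 1) * (B + 1)) * L.length + 1 := by
  cases L with
  | nil => simp [lowest]
  | cons Q L =>
    obtain ⟨hQ, hB⟩ := h Q List.mem_cons_self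
    have t1 := time_deg_le hQ.2
    have t2 := time_lowestFrom_le L Q hQ fun a ha => h a (List.mem_cons_of_mem _ ha)
    simp only [lowest, time_bind, time_tick, List.length_cons]
    have := Nat.mul_le_mul_left (2 * n + 3) hB
    nlinarith

theorem remainders_val (Q : Poly) (L : List Poly) :
    (remainders Q L).val = (L.map fun P => (add P Q).val).filter (· ≠ []) := by
  induction L with
  | nil => rfl
  | cons P L ih =>
    simp only [remainders, val_bind, ih]
    cases hR : (add P Q).val <;> simp [hR]

theorem time_remainders_le {n B : ℕ} (Q : Poly) (L : List Poly) (hQ : Valid n Q)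
    (hQB : Q.length ≤ B + 1) (h : ∀ P ∈ L, Valid n P ∧ P.length ≤ B + 1) :
    (remainders Q L).time ≤ 7 * ((n + 1) * (B + 1)) * L.length + 1 := by
  induction L with
  | nil => simp [remainders]
  | cons P L ih =>
    obtain ⟨hP, hB⟩ := h P List.mem_cons_self
    have hi := ih fun a ha => h a (List.mem_cons_of_mem _ ha)
    have t1 := (add_spec P Q hP hQ).2.2
    have t2 : (remainders Q (P :: L)).time = 1 + ((add P Q).time + (remainders Q L).time) := by
      simp only [remainders, time_bind, time_tick]
      split <;> simp
    rw [t2, List.length_cons]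
    have := Nat.mul_le_mul_left (n + 2) hB
    have := Nat.mul_le_mul_left (n + 2) hQB
    nlinarith

/-! ## The potential of a set of polynomials -/

/-- The number of subsets with fewer than `e` elements of a set with `c` elements. -/
def potential (c e : ℕ) : ℕ := ∑ i ∈ Finset.range e, c.choose i

theorem potential_mono {c c' e e' : ℕ} (hc : c ≤ c') (he : e ≤ e') :
    potential c e ≤ potential c' e' :=
  (Finset.sum_le_sum fun i _ => Nat.choose_le_choose i hc).trans
    (Finset.sum_le_sum_of_subset (Finset.range_mono he))

/-- Pascal's rule summed over the levels. The two summands are the weights available to the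
pseudo-remainder and to `I + 1`. -/
theorem potential_succ (c e : ℕ) :
    potential (c + 1) (e + 1) = potential c (e + 1) + potential c e := by
  simp only [potential]
  rw [Finset.sum_range_succ', Finset.sum_range_succ' (fun i => c.choose i)]
  simp only [Nat.choose_succ_succ', Finset.sum_add_distrib, Nat.choose_zero_right]
  ring

theorem one_le_potential (c : ℕ) {e : ℕ} (he : 1 ≤ e) : 1 ≤ potential c e :=
  le_trans (by simp [potential]) (potential_mono le_rfl he)

theorem potential_le_two_pow (c e : ℕ) : potential c e ≤ 2 ^ c := by
  rw [← Nat.sum_range_choose]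
  refine (potential_mono le_rfl (le_max_left e (c + 1))).trans (le_of_eq ?_)
  refine (Finset.sum_subset (Finset.range_mono (le_max_right e (c + 1))) fun i _ hi => ?_).symm
  exact Nat.choose_eq_zero_of_lt (by simpa using hi)

/-- Induction with `potential_succ`, using `2 * n ^ (e + 1) + 2 * n ^ e = 2 * n ^ e * (n + 1)`. The
factor 2 is already needed at `n = 1`, `e ≥ 1`. -/
theorem potential_le_two_mul_pow {n : ℕ} (hn : 1 ≤ n) (e : ℕ) :
    potential n (e + 1) ≤ 2 * n ^ e := by
  induction n, hn using Nat.le_induction generalizing e with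
  | base => simpa using potential_le_two_pow 1 (e + 1)
  | succ n hn ih =>
    cases e with
    | zero => simp [potential]
    | succ e =>
      rw [potential_succ]
      calc _ ≤ 2 * n ^ (e + 1) + 2 * n ^ e := Nat.add_le_add (ih _) (ih _)
        _ = 2 * (n ^ e * (n + 1)) := by ring
        _ ≤ 2 * ((n + 1) ^ e * (n + 1)) := by gcongr; omega
        _ = _ := by ring

theorem potential_le_pow (n e : ℕ) : potential n e ≤ (n + 1) ^ e := by
  induction n generalizing e with
  | zero => simpa using potential_le_two_pow 0 e
  | succ n ih =>
    cases e with
    | zero => simp [potential]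
    | succ e =>
      rw [potential_succ]
      calc _ ≤ (n + 1) ^ (e + 1) + (n + 1) ^ e := Nat.add_le_add (ih _) (ih _)
        _ = (n + 1) ^ e * (n + 1 + 1) := by ring
        _ ≤ (n + 1 + 1) ^ e * (n + 1 + 1) := by gcongr; omega
        _ = _ := by ring

/-! ## The invariant of the main loop -/

section Invariant

variable {ι : Type}

/-- The monomial `1` and the monomials of the members of a family with index in `R`. -/
def monomials (n : ℕ) (F : ι → Finset Mono) (R : Finset ι) : Finset Mono :=
  insert (List.replicate n false) (R.biUnion F)

theorem monomials_mono {n : ℕ} {F : ι → Finset Mono} {R R' : Finset ι} (h : R ⊆ R') :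
    monomials n F R ⊆ monomials n F R' :=
  Finset.insert_subset_insert _ (Finset.biUnion_subset_biUnion_of_subset_left _ h)

theorem one_mem_monomials (n : ℕ) (F : ι → Finset Mono) (R : Finset ι) :
    List.replicate n false ∈ monomials n F R := Finset.mem_insert_self _ _

/-- A stored polynomial whose monomials arise from members of `W` by setting the first `k`
exponents to zero. -/
def Below (n k : ℕ) (W : Finset Mono) (p : Poly) : Prop :=
  Valid n p ∧ ∀ m ∈ p, ∃ a ∈ W, m = clear k a

theorem Below.clear_eq {n k : ℕ} {W : Finset Mono} {p : Poly} (h : Below n k W p) :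
    ∀ m ∈ p, clear k m = m := by
  intro m hm
  obtain ⟨a, -, rfl⟩ := h.2 m hm
  exact clear_clear le_rfl a

/-- A valid polynomial has distinct monomials, and they all lie in the image of `W` under one map.
-/
theorem Below.length_le {n k : ℕ} {W : Finset Mono} {p : Poly} (h : Below n k W p) :
    p.length ≤ W.card := by
  have hn : p.Nodup := h.1.1.imp fun hab => ne_of_gt hab
  rw [← List.toFinset_card_of_nodup hn]
  refine (Finset.card_le_card ?_).trans (Finset.card_image_le (s := W) (f := clear k))
  intro m hm
  obtain ⟨a, ha, rfl⟩ := h.2 m (List.mem_toFinset.1 hm)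
  exact Finset.mem_image_of_mem _ ha

variable [DecidableEq ι]

/-- The invariant of the main loop when the first `k` variables are eliminated.  Every
polynomial has a source in the input, and its monomials come from those of its source and of at
most `k` further input polynomials. -/
structure Inv (F : ι → Finset Mono) (In : Finset ι) (n w l k : ℕ) (L : List Poly) : Prop where
  source : ∃ R ⊆ In, R.card ≤ k ∧ ∀ p ∈ L, ∃ i ∈ In, Below n k (monomials n F (insert i R)) p
  sum_le : (L.map fun p => potential (n - k) (deg p).val).sum ≤ w
  length_le : L.length ≤ l

variable {F : ι → Finset Mono} {In : Finset ι} {n w l k B : ℕ} {L : List Poly}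

theorem Inv.sublist (h : Inv F In n w l k L) {L' : List Poly} (hs : L'.Sublist L) :
    Inv F In n w l k L' := by
  obtain ⟨R, hR, hk, hp⟩ := h.source
  exact ⟨⟨R, hR, hk, fun p hm => hp p (hs.subset hm)⟩,
    ((hs.map _).sum_le_sum fun _ _ => Nat.zero_le _).trans h.sum_le,
    hs.length_le.trans h.length_le⟩

theorem Inv.clear_eq (h : Inv F In n w l k L) : ∀ p ∈ L, ∀ m ∈ p, clear k m = m := by
  obtain ⟨R, hR, hk, hp⟩ := h.source
  intro p hm
  obtain ⟨i, -, hb⟩ := hp p hm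
  exact hb.clear_eq

/-- The source together with the at most `k ≤ n` common inputs makes at most `n + 1` inputs, so `B`
need only bound the monomials of such subfamilies. -/
theorem Inv.valid (h : Inv F In n w l k L) (hkn : k ≤ n)
    (hB : ∀ R ⊆ In, R.card ≤ n + 1 → (monomials n F R).card ≤ B) :
    ∀ p ∈ L, Valid n p ∧ p.length ≤ B := by
  obtain ⟨R, hR, hk, hp⟩ := h.source
  intro p hm
  obtain ⟨i, hi, hb⟩ := hp p hm
  refine ⟨hb.1, hb.length_le.trans (hB _ (Finset.insert_subset hi hR) ?_)⟩
  exact (Finset.card_insert_le _ _).trans (by omega)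

/-! ### Degrees and monomials under one elimination -/

theorem one_le_deg {p : Poly} {i : ℕ} (h : (leadPos p).val = some i) : 1 ≤ (deg p).val := by
  cases p with
  | nil => simp [leadPos] at h
  | cons m p =>
    obtain ⟨-, h2, -⟩ := leadMono_some (m := m) (i := i) (by simpa [leadPos] using h)
    have h3 := count_clear_succ h2
    have h4 := count_le_deg (p := m :: p) List.mem_cons_self
    omega

/-- Each monomial of the initial has lost the eliminated variable, and the added monomial `1` has
degree zero. -/
theorem deg_initialAddOne {j : ℕ} {P : Poly} (h : Valid n P) (hP : ∀ m ∈ P, clear j m = m)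
    (hd : 1 ≤ (deg P).val) : (deg (initialAddOne n j P)).val + 1 ≤ (deg P).val := by
  have : (deg (initialAddOne n j P)).val ≤ (deg P).val - 1 := by
    refine deg_val_le_iff.2 fun m hm => ?_
    rcases mem_initialAddOne h hP hm with ⟨a, ha, hv, rfl⟩ | rfl
    · have h1 := count_clear_succ hv
      have h2 := count_le_deg ha
      omega
    · simp [List.count_replicate]
  omega

theorem deg_monic_le {j : ℕ} {P : Poly} (hd : 1 ≤ (deg P).val) :
    (deg (monic n j P)).val ≤ (deg P).val := by
  refine deg_val_le_iff.2 fun m hm => ?_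
  rcases List.mem_cons.1 hm with rfl | hm
  · exact (count_varMono_le n j).trans hd
  · exact count_le_deg (List.mem_filter.1 hm).1

theorem mem_add_monic {j : ℕ} {P Q : Poly} (hP : Valid n P) (hQ : Valid n Q) :
    Valid n (add (monic n j P) (monic n j Q)).val ∧
      ∀ m ∈ (add (monic n j P) (monic n j Q)).val, m ∈ free j P ∨ m ∈ free j Q := by
  rw [monic, monic, add_cons_self]
  have := add_spec _ _ (hP.free (j := j)) (hQ.free (j := j))
  exact ⟨this.1, this.2.1⟩

/-- This is where the choice of a pivot of lowest degree matters: without it the degree of the pivot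
could exceed that of `P`. -/
theorem deg_add_monic_le {j : ℕ} {P Q : Poly} (hP : Valid n P) (hQ : Valid n Q)
    (hd : 1 ≤ (deg P).val) (h : (deg (monic n j Q)).val ≤ (deg (monic n j P)).val) :
    (deg (add (monic n j P) (monic n j Q)).val).val ≤ (deg P).val := by
  refine le_trans (deg_val_le_iff.2 fun m hm => ?_) (deg_monic_le (n := n) (j := j) hd)
  rcases (mem_add_monic hP hQ).2 m hm with hm | hm
  · exact count_le_deg (List.mem_cons_of_mem _ hm)
  · exact (count_le_deg (List.mem_cons_of_mem _ hm)).trans h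

/-- One elimination preserves the invariant. -/
theorem Inv.eliminate (h : Inv F In n w l k L) (hl : 2 * w ≤ l)
    (hkn : k ≤ n) (hlead : ∀ p ∈ L, (leadPos p).val ≠ none) {j : ℕ}
    (hj : (topPos L).val = some j) {L₁ M : List Poly} {Q : Poly}
    (h₁ : L₁.Perm (selectTop j L).val.1) (hM : M.Perm (L₁.map (monic n j)).reverse)
    (hQ : Q = (lowest M).val) :
    k ≤ j ∧ j < n ∧ Inv F In n w l (j + 1)
      (((L₁.map (initialAddOne n j)).reverse ++ (selectTop j L).val.2) ++
        ((L₁.map (monic n j)).reverse.map fun P => (add P Q).val).filter (· ≠ [])) := by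
  have hsub : (((L₁.map (monic n j)).reverse.map fun P => (add P Q).val).filter
      (· ≠ [])).Sublist _ := List.filter_sublist
  generalize (((L₁.map (monic n j)).reverse.map fun P => (add P Q).val).filter
    (· ≠ [])) = Rm at hsub ⊢
  obtain ⟨R, hR, hk, hp⟩ := h.source
  obtain ⟨⟨p₀, hp₀, hlp₀⟩, hmin⟩ := topPos_some hj
  obtain ⟨hs, hs1, hs2⟩ := selectTop_spec j L
  set QS := (selectTop j L).val.2
  have hperm : (L₁ ++ QS).Perm L := (h₁.append_right QS).trans hs
  have hval : ∀ p ∈ L, Valid n p := fun p hm => by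
    obtain ⟨i, -, hb⟩ := hp p hm
    exact hb.1
  have hkj : k ≤ j := le_of_leadPos hlp₀ (h.clear_eq p₀ hp₀)
  have hjn : j < n := (clear_eq_of_leadPos (hval p₀ hp₀) hlp₀).1
  have hcl : ∀ p ∈ L, ∀ m ∈ p, clear j m = m := fun p hm a ha => by
    obtain ⟨i, hi⟩ := Option.ne_none_iff_exists'.1 (hlead p hm)
    exact clear_eq_of_le (hmin p hm i hi) ((clear_eq_of_leadPos (hval p hm) hi).2 a ha)
  have hdeg : ∀ p ∈ L, 1 ≤ (deg p).val := fun p hm => by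
    obtain ⟨i, hi⟩ := Option.ne_none_iff_exists'.1 (hlead p hm)
    exact one_le_deg hi
  have hL₁ : ∀ p ∈ L₁, p ∈ L := fun p hm => hperm.subset (List.mem_append_left _ hm)
  have hQS : ∀ p ∈ QS, p ∈ L := fun p hm => hperm.subset (List.mem_append_right _ hm)
  have hne : L₁ ≠ [] := by
    intro h0
    have h1 := hperm.symm.subset hp₀
    rw [h0, List.nil_append] at h1
    exact lt_irrefl _ (hs2 p₀ h1 j hlp₀)
  have hMne : M ≠ [] := by
    intro h0
    have := hM.length_eq
    simp only [h0, List.length_nil, List.length_reverse, List.length_map] at this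
    exact hne (List.length_eq_zero_iff.1 this.symm)
  obtain ⟨hQM, hQmin⟩ := lowest_spec hMne
  rw [← hQ] at hQM hQmin
  obtain ⟨P₀, hP₀, hP₀Q⟩ : ∃ P₀ ∈ L₁, monic n j P₀ = Q := by
    simpa using hM.subset hQM
  have hmon : ∀ P ∈ L₁, monic n j P ∈ M := fun P hP =>
    hM.symm.subset (List.mem_reverse.2 (List.mem_map_of_mem hP))
  obtain ⟨i₀, hi₀, hb₀⟩ := hp P₀ (hL₁ P₀ hP₀)
  -- The common set grows only by the source of the pivot. Its size is at most `k + 1 ≤ j + 1`.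
  refine ⟨hkj, hjn, ⟨insert i₀ R, Finset.insert_subset hi₀ hR,
    (Finset.card_insert_le _ _).trans (by omega), ?_⟩, ?_, ?_⟩
  · have key : ∀ i : ι, ∀ a ∈ monomials n F (insert i R),
        a ∈ monomials n F (insert i (insert i₀ R)) := fun i a ha =>
      monomials_mono (Finset.insert_subset_insert _ (Finset.subset_insert _ _)) ha
    have key0 : ∀ i : ι, ∀ a ∈ monomials n F (insert i₀ R),
        a ∈ monomials n F (insert i (insert i₀ R)) := fun i a ha =>
      monomials_mono (Finset.subset_insert _ _) ha
    intro p hmem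
    rcases List.mem_append.1 hmem with hmem | hmem
    · rcases List.mem_append.1 hmem with hmem | hmem
      · obtain ⟨P, hP, rfl⟩ := List.mem_map.1 (List.mem_reverse.1 hmem)
        obtain ⟨i, hi, hb⟩ := hp P (hL₁ P hP)
        have hc := hcl P (hL₁ P hP)
        refine ⟨i, hi, hb.1.initialAddOne hc, fun m hm => ?_⟩
        rcases mem_initialAddOne hb.1 hc hm with ⟨a, ha, -, rfl⟩ | rfl
        · obtain ⟨a', ha', rfl⟩ := hb.2 a ha
          exact ⟨a', key i a' ha', clear_clear (by omega) _⟩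
        · exact ⟨_, one_mem_monomials n F _, (clear_replicate _ _).symm⟩
      · obtain ⟨i, hi, hb⟩ := hp p (hQS p hmem)
        obtain ⟨i', hi'⟩ := Option.ne_none_iff_exists'.1 (hlead p (hQS p hmem))
        have hlt := hs2 p hmem i' hi'
        refine ⟨i, hi, hb.1, fun m hm => ?_⟩
        -- An untouched polynomial has leading position beyond `j`, so its first `j + 1` exponents
        -- are already zero.
        have hc := clear_eq_of_le (show j + 1 ≤ i' by omega)
          ((clear_eq_of_leadPos hb.1 hi').2 m hm)
        obtain ⟨a, ha, rfl⟩ := hb.2 m hm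
        exact ⟨a, key i a ha, by rw [← clear_clear (show k ≤ j + 1 by omega), hc]⟩
    · obtain ⟨P', hP', rfl⟩ := List.mem_map.1 (hsub.subset hmem)
      obtain ⟨P, hP, rfl⟩ := List.mem_map.1 (List.mem_reverse.1 hP')
      obtain ⟨i, hi, hb⟩ := hp P (hL₁ P hP)
      rw [← hP₀Q]
      obtain ⟨hv, hm'⟩ := mem_add_monic (j := j) hb.1 hb₀.1
      refine ⟨i, hi, hv, fun m hm => ?_⟩
      rcases hm' m hm with hm | hm
      · have hc := clear_free (hcl P (hL₁ P hP)) m hm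
        obtain ⟨a, ha, rfl⟩ := hb.2 m (List.mem_filter.1 hm).1
        exact ⟨a, key i a ha, by rw [← clear_clear (show k ≤ j + 1 by omega), hc]⟩
      · have hc := clear_free (hcl P₀ (hL₁ P₀ hP₀)) m hm
        obtain ⟨a, ha, rfl⟩ := hb₀.2 m (List.mem_filter.1 hm).1
        exact ⟨a, key0 i a ha, by rw [← clear_clear (show k ≤ j + 1 by omega), hc]⟩
  · refine le_trans ?_ h.sum_le
    rw [← (hperm.map _).sum_eq]
    simp only [List.map_append, List.sum_append, List.map_reverse, List.sum_reverse,
      List.map_map]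
    set c := n - (j + 1)
    -- At least one variable is used up; more if positions between `k` and `j` do not occur.
    have hc : c + 1 ≤ n - k := by omega
    have e1 : (Rm.map fun p => potential c (deg p).val).sum
        ≤ (L₁.map fun P => potential c (deg (add (monic n j P) Q).val).val).sum := by
      refine ((hsub.map _).sum_le_sum fun _ _ => Nat.zero_le _).trans
        (le_of_eq ?_)
      simp [List.map_reverse, List.sum_reverse, Function.comp_def]
    have e2 : (QS.map fun p => potential c (deg p).val).sum
        ≤ (QS.map fun p => potential (n - k) (deg p).val).sum :=
      List.sum_le_sum fun p _ => potential_mono (by omega) le_rfl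
    have e3 : (L₁.map fun P => potential c (deg (initialAddOne n j P)).val).sum +
        (L₁.map fun P => potential c (deg (add (monic n j P) Q).val).val).sum
        ≤ (L₁.map fun p => potential (n - k) (deg p).val).sum := by
      rw [← List.sum_map_add]
      refine List.sum_le_sum fun P hP => ?_
      have hd := hdeg P (hL₁ P hP)
      have d1 := deg_initialAddOne (hval P (hL₁ P hP)) (hcl P (hL₁ P hP)) hd
      have d2 : (deg (add (monic n j P) Q).val).val ≤ (deg P).val := by
        have := hQmin _ (hmon P hP)
        rw [← hP₀Q] at this ⊢
        exact deg_add_monic_le (hval P (hL₁ P hP)) (hval P₀ (hL₁ P₀ hP₀)) hd this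
      obtain ⟨e, he⟩ : ∃ e, (deg P).val = e + 1 := ⟨(deg P).val - 1, by omega⟩
      rw [he] at d1 d2 ⊢
      refine le_trans ?_ (potential_mono hc le_rfl)
      rw [potential_succ, add_comm]
      exact Nat.add_le_add (potential_mono le_rfl d2) (potential_mono le_rfl (by omega))
    simp only [Function.comp_def] at e1 e2 e3 ⊢
    omega
  -- The new list may contain constants of weight zero, so its length is bounded through the old
  -- list, whose members all weigh at least one. Each of them yields at most two polynomials.
  · have hw : L.length ≤ w := by
      refine le_trans ?_ h.sum_le
      have : L.length = (L.map fun _ => 1).sum := by simp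
      rw [this]
      exact List.sum_le_sum fun p hm => one_le_potential _ (hdeg p hm)
    have h2 := hperm.length_eq
    have h3 := hsub.length_le
    simp only [List.length_append, List.length_reverse, List.length_map] at h2 h3 ⊢
    omega

/-- One pass: its cost, and the preservation of the invariant. -/
theorem Inv.round (ρ : ChoiceRule) (s : State) (h : Inv F In n w l k s.PS) (hl : 2 * w ≤ l)
    (hkn : k ≤ n) (hB : ∀ R ⊆ In, R.card ≤ n + 1 → (monomials n F R).card ≤ B) :
    (round n ρ s).time ≤ 50 * ((n + 1) * (B + 1)) * (l + 1) ∧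
      ((∃ o, (round n ρ s).val = .inr o) ∨
        ∃ s' j, (round n ρ s).val = .inl s' ∧ k ≤ j ∧ j < n ∧
          Inv F In n w l (j + 1) s'.PS) := by
  have hz : Inv F In n w l k (dropZeros s.PS).val := by
    rw [dropZeros_val]
    exact h.sublist List.filter_sublist
  have hPS := hz.sublist (removeDup_sublist .leaf (dropZeros s.PS).val)
  have hne : ∀ p ∈ (removeDup .leaf (dropZeros s.PS).val).val, p ≠ [] := fun p hm => by
    have := (removeDup_sublist .leaf (dropZeros s.PS).val).subset hm
    rw [dropZeros_val] at this
    simpa using (List.mem_filter.1 this).2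
  have hval := hPS.valid hkn hB
  have t1 := time_dropZeros s.PS
  have t2 := time_removeDup_le .leaf _ (hz.valid hkn hB)
  have t3 := time_hasOne_le fun p hm => (hval p hm).1
  have t4 := time_topPos_le fun p hm => (hval p hm).1
  have l0 := h.length_le
  have l1 := hz.length_le
  have l2 := hPS.length_le
  set PS := (removeDup .leaf (dropZeros s.PS).val).val with hPSdef
  have hu : n + 1 ≤ (n + 1) * (B + 1) := Nat.le_mul_of_pos_right _ (by omega)
  have hu1 : 1 ≤ (n + 1) * (B + 1) := by nlinarith
  -- The unit of cost: up to a constant, the price of one traversal of one polynomial. Every routine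
  -- of the pass is bounded by a constant times `u * l`, plus one.
  set u := (n + 1) * (B + 1)
  have t2' : (removeDup .leaf (dropZeros s.PS).val).time ≤ 5 * (u * l) + 1 := by
    refine t2.trans ?_
    rw [mul_assoc]
    gcongr
  have hv : ∀ x ≤ l, 3 * (n + 1) * x + 1 ≤ 3 * (u * l) + 1 := fun x hx => by
    rw [mul_assoc]
    gcongr
  have t3' := t3.trans (hv _ l2)
  have t4' := t4.trans (hv _ l2)
  have hul : l ≤ u * l := Nat.le_mul_of_pos_left _ hu1
  have hgoal : 50 * u * (l + 1) = 50 * (u * l) + 50 * u := by ring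
  rw [hgoal]
  cases ho : (hasOne PS).val with
  | true =>
    refine ⟨?_, .inl ?_⟩
    · simp only [MFTri.round, time_bind, time_tick, ← hPSdef, ho, if_true, time_pure]
      omega
    · simp only [MFTri.round, val_bind, ← hPSdef, ho, if_true, val_pure]
      exact ⟨_, rfl⟩
  | false =>
    cases ht : (topPos PS).val with
    | none =>
      refine ⟨?_, .inl ?_⟩
      · simp only [MFTri.round, time_bind, time_tick, ← hPSdef, ho, ht, time_pure,
          Bool.false_eq_true, if_false]
        omega
      · simp only [MFTri.round, val_bind, ← hPSdef, ho, ht, val_pure,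
          Bool.false_eq_true, if_false]
        exact ⟨_, rfl⟩
    | some j =>
      have hlead : ∀ p ∈ PS, (leadPos p).val ≠ none := fun p hm =>
        leadPos_ne_none (hval p hm).1 (hne p hm) (hasOne_eq_false ho p hm)
      have h₁ := ρ.perm₁ (selectTop j PS).val.1
      obtain ⟨hs, -, -⟩ := selectTop_spec j PS
      have hmem : ∀ P ∈ ρ.order₁ (selectTop j PS).val.1, P ∈ PS := fun P hP =>
        hs.subset (List.mem_append_left _ (h₁.subset hP))
      have hjn : j < n := by
        obtain ⟨⟨p, hp, hlp⟩, -⟩ := topPos_some ht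
        exact (clear_eq_of_leadPos (hval p hp).1 hlp).1
      have hcl : ∀ p ∈ PS, ∀ m ∈ p, clear j m = m := fun p hm a ha => by
        obtain ⟨i, hi⟩ := Option.ne_none_iff_exists'.1 (hlead p hm)
        exact clear_eq_of_le ((topPos_some ht).2 p hm i hi)
          ((clear_eq_of_leadPos (hval p hm).1 hi).2 a ha)
      have hmm := makeMonic_val hjn s.A (ρ.order₁ (selectTop j PS).val.1)
        (selectTop j PS).val.2 [] s.PSstar
        fun P hP => ⟨(hval P (hmem P hP)).1, hcl P (hmem P hP)⟩
      have t5 := time_selectTop_le j fun p hm => (hval p hm).1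
      have t6 := time_makeMonic_le s.A (ρ.order₁ (selectTop j PS).val.1)
        (selectTop j PS).val.2 [] s.PSstar
        fun P hP => ⟨(hval P (hmem P hP)).1, hcl P (hmem P hP), (hval P (hmem P hP)).2⟩
      rw [List.append_nil] at hmm
      set L₁ := ρ.order₁ (selectTop j PS).val.1
      set mm := makeMonic n j s.A L₁ (selectTop j PS).val.2 [] s.PSstar
      have hM := ρ.perm₂ mm.val.2.1
      have hmv : ∀ P ∈ mm.val.2.1, Valid n P ∧ P.length ≤ B + 1 := by
        rw [hmm.2]
        intro P' hP'
        obtain ⟨P, hP, rfl⟩ := List.mem_map.1 (List.mem_reverse.1 hP')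
        have hv' := hval P (hmem P hP)
        refine ⟨hv'.1.monic hjn (hcl P (hmem P hP)), ?_⟩
        have := List.length_filter_le (fun m => !hasVar j m) P
        have h' := hv'.2
        simp only [monic, free, List.length_cons]
        omega
      have hMv : ∀ P ∈ ρ.order₂ mm.val.2.1, Valid n P ∧ P.length ≤ B + 1 := fun P hP =>
        hmv P (hM.subset hP)
      have hlow : Valid n (lowest (ρ.order₂ mm.val.2.1)).val ∧
          (lowest (ρ.order₂ mm.val.2.1)).val.length ≤ B + 1 := by
        -- On an empty list `lowest` returns the zero polynomial, which also satisfies both bounds,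
        -- so nonemptiness need not be shown here.
        by_cases h0 : ρ.order₂ mm.val.2.1 = []
        · rw [h0]
          exact ⟨⟨by simp [lowest], by simp [lowest]⟩, by simp [lowest]⟩
        · exact hMv _ (lowest_spec h0).1
      have t7 := time_lowest_le _ hMv
      have t8 := time_remainders_le _ _ hlow.1 hlow.2 hmv
      have e2 : mm.val.2.1.length = L₁.length := by rw [hmm.2]; simp
      have e1 : mm.val.1.length = PS.length := by
        have := (h₁.append_right (selectTop j PS).val.2).trans hs
        rw [hmm.1, ← this.length_eq]
        simp
      have e3 : L₁.length ≤ l := by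
        refine le_trans ?_ l2
        have := (h₁.append_right (selectTop j PS).val.2).trans hs
        rw [← this.length_eq]
        simp
      refine ⟨?_, .inr ?_⟩
      · have t5' := t5.trans (hv _ l2)
        have hw : ∀ K x, x ≤ l → K * u * x + 1 ≤ K * (u * l) + 1 := fun K x hx => by
          rw [mul_assoc]
          gcongr
        have t6' := t6.trans (hw 12 _ e3)
        have t7' := t7.trans (hw 6 _ (by rw [hM.length_eq, e2]; exact e3))
        have t8' := t8.trans (hw 7 _ (by rw [e2]; exact e3))
        simp only [MFTri.round, time_bind, time_tick, ← hPSdef, ho, ht, time_pure,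
          Bool.false_eq_true, if_false, time_append]
        change 1 + ((dropZeros s.PS).time + ((removeDup .leaf (dropZeros s.PS).val).time +
          ((hasOne PS).time + ((topPos PS).time + ((selectTop j PS).time + (mm.time +
          ((lowest (ρ.order₂ mm.val.2.1)).time +
          ((remainders (lowest (ρ.order₂ mm.val.2.1)).val mm.val.2.1).time +
          (mm.val.1.length + 1 + 0))))))))) ≤ _
        omega
      · have hel := hPS.eliminate hl hkn hlead ht (L₁ := L₁) (M := ρ.order₂ mm.val.2.1)
          h₁ (hmm.2 ▸ hM) rfl
        refine ⟨⟨(append mm.val.1 (remainders (lowest (ρ.order₂ mm.val.2.1)).val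
          mm.val.2.1).val).val, (lowest (ρ.order₂ mm.val.2.1)).val :: s.A, mm.val.2.2⟩,
          j, ?_, hel.1, hel.2.1, ?_⟩
        · simp only [MFTri.round, val_bind, ← hPSdef, ho, ht, val_pure,
            Bool.false_eq_true, if_false]
          rfl
        · have := hel.2.2
          rw [← hmm.1, ← hmm.2] at this
          simpa only [append_val, remainders_val] using this

theorem exists_runs_of_inv (ρ : ChoiceRule) (hl : 2 * w ≤ l)
    (hB : ∀ R ⊆ In, R.card ≤ n + 1 → (monomials n F R).card ≤ B) (s : State) (hkn : k ≤ n)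
    (h : Inv F In n w l k s.PS) :
    ∃ o t, Runs n ρ s o t ∧ t ≤ (n - k + 1) * (50 * ((n + 1) * (B + 1)) * (l + 1)) := by
  -- Strong induction is needed because a pass may skip variables. At `k = n` the pass must halt, as
  -- `k ≤ j < n` is impossible.
  induction hr : n - k using Nat.strong_induction_on generalizing k s with
  | _ r ih =>
    obtain ⟨ht, ⟨o, ho⟩ | ⟨s', j, hs', hkj, hjn, hi⟩⟩ := h.round ρ s hl hkn hB
    · exact ⟨o, _, .halt s o ho, ht.trans (Nat.le_mul_of_pos_left _ (by omega))⟩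
    · obtain ⟨o, t, hrun, hle⟩ := ih (n - (j + 1)) (by omega) s' (by omega) hi rfl
      refine ⟨o, _, .next s s' o t hs' hrun, ?_⟩
      have : (n - (j + 1) + 1 + 1) * (50 * ((n + 1) * (B + 1)) * (l + 1))
          ≤ (r + 1) * (50 * ((n + 1) * (B + 1)) * (l + 1)) :=
        Nat.mul_le_mul_right _ (by omega)
      linarith

end Invariant

/-! ## The running time for a given input -/

theorem count_ofFn_le {n : ℕ} (f : Fin n → Bool) (g : Fin n → ℕ) (h : ∀ i, f i = true → 1 ≤ g i) :
    (List.ofFn f).count true ≤ ∑ i, g i := by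
  induction n with
  | zero => simp
  | succ n ih =>
    have h1 := ih (fun i => f i.succ) (fun i => g i.succ) fun i => h i.succ
    have h2 := h 0
    rw [List.ofFn_succ, Fin.sum_univ_succ]
    cases h0 : f 0
    · simp; omega
    · simp only [List.count_cons_self]
      have := h2 h0
      omega

/-- The bits record only which exponents are nonzero, and each of these contributes at least one to
the degree. -/
theorem count_bits_le {n : ℕ} (m : Fin n →₀ ℕ) : (bits m).count true ≤ m.sum fun _ e => e := by
  refine (count_ofFn_le _ (fun i => m i.rev) fun i hi => ?_).trans (le_of_eq ?_)
  · exact Nat.one_le_iff_ne_zero.2 (by simpa using hi)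
  · rw [Finsupp.sum_fintype _ _ fun _ => rfl]
    exact Equiv.sum_comp Fin.revPerm m

theorem mem_encode {n : ℕ} {P : MvPolynomial (Fin n) (ZMod 2)} {m : Mono} :
    m ∈ encode P ↔ m ∈ P.support.image bits := Finset.mem_sort _

theorem valid_encode {n : ℕ} (P : MvPolynomial (Fin n) (ZMod 2)) : Valid n (encode P) := by
  refine ⟨(Finset.sortedGT_sort _).pairwise, fun m hm => ?_⟩
  obtain ⟨a, -, rfl⟩ := Finset.mem_image.1 (mem_encode.1 hm)
  simp [bits]

theorem deg_encode_le {n : ℕ} (P : MvPolynomial (Fin n) (ZMod 2)) :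
    (deg (encode P)).val ≤ P.totalDegree := by
  refine deg_val_le_iff.2 fun m hm => ?_
  obtain ⟨a, ha, rfl⟩ := Finset.mem_image.1 (mem_encode.1 hm)
  exact (count_bits_le a).trans (MvPolynomial.le_totalDegree ha)

theorem card_monomials_le {n : ℕ} (R : Finset (MvPolynomial (Fin n) (ZMod 2))) :
    (monomials n (fun P => P.support.image bits) R).card ≤ ∑ P ∈ R, term P + 1 := by
  classical
  refine (Finset.card_insert_le _ _).trans (Nat.add_le_add_right ?_ 1)
  exact Finset.card_biUnion_le.trans (Finset.sum_le_sum fun P _ => Finset.card_image_le)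

theorem IsInput.length_eq {n : ℕ} {PS : Finset (MvPolynomial (Fin n) (ZMod 2))}
    {L : List (MvPolynomial (Fin n) (ZMod 2))} (h : IsInput PS L) : L.length = PS.card := by
  classical
  rw [← List.toFinset_card_of_nodup h.2.1]
  congr 1
  ext P
  rw [List.mem_toFinset, h.2.2]

/-- The bound on the number of terms of the polynomials that occur. -/
def termBound {n : ℕ} (PS : Finset (MvPolynomial (Fin n) (ZMod 2))) : ℕ :=
  min (∑ P ∈ PS, term P) ((n + 1) * PS.sup term) + 1

/-- Halting, with a bound on the number of steps; if `d = 0`, all variables may be considered as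
eliminated from the beginning. -/
theorem exists_runs {n d k : ℕ} {PS : Finset (MvPolynomial (Fin n) (ZMod 2))}
    {L : List (MvPolynomial (Fin n) (ZMod 2))} (ρ : ChoiceRule) (h : IsInput PS L)
    (hd : ∀ P ∈ PS, P.totalDegree ≤ d) (hk : k = 0 ∨ k = n ∧ d = 0) :
    ∃ o t, Runs n ρ (start L) o t ∧
      t ≤ (n - k + 1) * (50 * ((n + 1) * (termBound PS + 1)) *
        (PS.card + 2 * (PS.card * potential n d) + 1)) := by
  classical
  have hlen := h.length_eq
  refine exists_runs_of_inv (In := PS) (F := fun P => P.support.image bits)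
    (w := PS.card * potential n d) (k := k) ρ (by omega) (fun R hR hc => ?_) _ (by omega)
    ⟨⟨∅, Finset.empty_subset _, Nat.zero_le _, ?_⟩, ?_, ?_⟩
  -- A subfamily of at most `n + 1` inputs is bounded in two ways, by the sum over all inputs and by
  -- `n + 1` times the maximum. The final `+ 1` accounts for the monomial `1`.
  · refine (card_monomials_le R).trans (Nat.add_le_add_right (le_min ?_ ?_) 1)
    · exact Finset.sum_le_sum_of_subset hR
    · refine (Finset.sum_le_card_nsmul R term (PS.sup term) fun P hP =>
        Finset.le_sup (f := term) (hR hP)).trans ?_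
      exact Nat.mul_le_mul_right _ hc
  · intro p hp
    obtain ⟨P, hP, rfl⟩ := List.mem_map.1 hp
    refine ⟨P, (h.2.2 P).1 hP, valid_encode P, fun m hm => ⟨m, ?_, ?_⟩⟩
    · exact Finset.mem_insert_of_mem (Finset.mem_biUnion.2
        ⟨P, Finset.mem_insert_self _ _, mem_encode.1 hm⟩)
    · rcases hk with rfl | ⟨rfl, rfl⟩
      · simp
      · refine (clear_eq_of_count_eq_zero ?_ _).symm
        have h1 := count_le_deg hm
        have h2 := deg_encode_le P
        have h3 := hd P ((h.2.2 P).1 hP)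
        omega
  · have := List.sum_le_card_nsmul (((start L).PS).map fun p => potential (n - k) (deg p).val)
      (potential n d) fun x hx => ?_
    · simpa [start, hlen] using this
    · obtain ⟨p, hp, rfl⟩ := List.mem_map.1 hx
      obtain ⟨P, hP, rfl⟩ := List.mem_map.1 hp
      exact potential_mono (by omega)
        ((deg_encode_le P).trans (hd P ((h.2.2 P).1 hP)))
  · simp [start, hlen]

theorem one_le_sum_term {n : ℕ} {PS : Finset (MvPolynomial (Fin n) (ZMod 2))}
    (h0 : ∃ P ∈ PS, P ≠ 0) :
    1 ≤ PS.card ∧ 1 ≤ ∑ P ∈ PS, term P ∧ 1 ≤ PS.sup term := by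
  obtain ⟨P, hP, hne⟩ := h0
  have : 1 ≤ term P := Finset.card_pos.2 (MvPolynomial.support_nonempty.2 hne)
  exact ⟨Finset.card_pos.2 ⟨P, hP⟩,
    this.trans (Finset.single_le_sum (f := term) (fun _ _ => Nat.zero_le _) hP),
    this.trans (Finset.le_sup (f := term) hP)⟩

theorem exists_runs_le {n d : ℕ} {PS : Finset (MvPolynomial (Fin n) (ZMod 2))}
    {L : List (MvPolynomial (Fin n) (ZMod 2))} (ρ : ChoiceRule) (hn : 0 < n)
    (h : IsInput PS L) (h0 : ∃ P ∈ PS, P ≠ 0) (hd : ∀ P ∈ PS, P.totalDegree ≤ d) :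
    ∃ o t, Runs n ρ (start L) o t ∧
      t ≤ 1200 * (PS.card * n ^ (d + 1) * (termBound PS + 1)) := by
  obtain ⟨hl, -, -⟩ := one_le_sum_term h0
  set l := PS.card
  set b := termBound PS + 1
  cases d with
  | zero =>
    -- For `d = 0` the bound has only one factor `n`, so there is no room to charge for `n + 1`
    -- passes. Starting the invariant at `k = n` charges for a single pass, and the weight is zero.
    obtain ⟨o, t, hr, ht⟩ := exists_runs (k := n) ρ h hd (.inr ⟨rfl, rfl⟩)
    refine ⟨o, t, hr, ht.trans ?_⟩
    calc _ = 50 * ((n + 1) * b) * (l + 1) := by simp [potential, l, b]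
      _ ≤ 50 * ((n + n) * b) * (l + l) := by gcongr; omega
      _ = 200 * (l * n ^ (0 + 1) * b) := by ring
      _ ≤ _ := by gcongr; omega
  | succ e =>
    obtain ⟨o, t, hr, ht⟩ := exists_runs (k := 0) ρ h hd (.inl rfl)
    have hp := potential_le_two_mul_pow hn e
    have hne : 1 ≤ n ^ e := Nat.one_le_pow _ _ hn
    have hle : 1 ≤ l * n ^ e := Nat.mul_pos hl hne
    have hln : l ≤ l * n ^ e := Nat.le_mul_of_pos_right _ hne
    refine ⟨o, t, hr, ht.trans ?_⟩
    -- The constant is `2 * 50 * 2 * 6`: two factors `n + 1 ≤ 2 * n`, and six copies of `l * n ^ e`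
    -- from the list length.
    calc _ = (n + 1) * (50 * ((n + 1) * b) * (l + 2 * (l * potential n (e + 1)) + 1)) := rfl
      _ ≤ (n + n) * (50 * ((n + n) * b) *
          (l * n ^ e + 2 * (l * (2 * n ^ e)) + l * n ^ e)) := by gcongr <;> omega
      _ = 1200 * (l * n ^ (e + 1 + 1) * b) := by ring

theorem term_le_inputSize {n : ℕ} (PS : Finset (MvPolynomial (Fin n) (ZMod 2))) :
    PS.card ≤ inputSize PS ∧ ∑ P ∈ PS, term P ≤ inputSize PS := by
  constructor
  · rw [Finset.card_eq_sum_ones]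
    exact Finset.sum_le_sum fun P _ => Nat.le_add_left _ _
  · exact Finset.sum_le_sum fun P _ => by nlinarith [Nat.zero_le (term P * n)]

/-- A nonzero polynomial has a monomial, which is written with `n` bits. Without one, `n` is not
bounded by the input size, and `exists_runs_zero` takes over. -/
theorem le_inputSize {n : ℕ} {PS : Finset (MvPolynomial (Fin n) (ZMod 2))}
    (h0 : ∃ P ∈ PS, P ≠ 0) : n ≤ inputSize PS := by
  obtain ⟨P, hP, hne⟩ := h0
  have h1 : 1 ≤ term P := Finset.card_pos.2 (MvPolynomial.support_nonempty.2 hne)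
  refine le_trans ?_ (Finset.single_le_sum (f := fun P => term P * (n + 1) + 1)
    (fun _ _ => Nat.zero_le _) hP)
  nlinarith

/-- The list is empty or consists of the single polynomial `0`, so the only pass can be evaluated
outright, with a cost independent of `n`. -/
theorem exists_runs_zero {n : ℕ} {PS : Finset (MvPolynomial (Fin n) (ZMod 2))}
    {L : List (MvPolynomial (Fin n) (ZMod 2))} (ρ : ChoiceRule) (h : IsInput PS L)
    (h0 : ∀ P ∈ PS, P = 0) : ∃ o t, Runs n ρ (start L) o t ∧ t ≤ 6 := by
  have henc : encode (0 : MvPolynomial (Fin n) (ZMod 2)) = [] := by simp [encode]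
  have hL : ∀ P ∈ L, P = 0 := fun P hP => h0 P ((h.2.2 P).1 hP)
  have hs : (start L).PS = [] ∨ (start L).PS = [[]] := by
    match L, h.2.1, hL with
    | [], _, _ => exact .inl rfl
    | [P], _, hL =>
      obtain rfl := hL P (by simp)
      exact .inr (by simp [start, henc])
    | P :: Q :: L, hnd, hL =>
      have h1 := hL P (by simp)
      have h2 := hL Q (by simp)
      simp [h1, h2] at hnd
  have hst : start L = ⟨(start L).PS, [], []⟩ := rfl
  rw [hst]
  rcases hs with hs | hs <;> rw [hs]
  · exact ⟨_, _, .halt _ ⟨[], []⟩ rfl, by change 5 ≤ 6; omega⟩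
  · exact ⟨_, _, .halt _ ⟨[], []⟩ rfl, le_refl 6⟩

end MFTri

/-! ### The two complexity bounds -/

theorem mainTheorem5 :
    (∃ C : ℕ, ∀ (n d : ℕ) (PS : Finset (MvPolynomial (Fin n) (ZMod 2)))
        (L : List (MvPolynomial (Fin n) (ZMod 2))) (ρ : MFTri.ChoiceRule),
        0 < n → MFTri.IsInput PS L → (∃ P ∈ PS, P ≠ 0) → (∀ P ∈ PS, P.totalDegree ≤ d) →
        ∃ (o : MFTri.Output) (t : ℕ), MFTri.Runs n ρ (MFTri.start L) o t ∧
          t ≤ C * (PS.card * n ^ (d + 1) * ∑ P ∈ PS, MFTri.term P) ∧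
          (n ≤ PS.card → t ≤ C * (PS.card * n ^ (d + 2) * PS.sup MFTri.term))) ∧
    (∀ d : ℕ, ∃ p : Polynomial ℕ, ∀ (n : ℕ) (PS : Finset (MvPolynomial (Fin n) (ZMod 2)))
        (L : List (MvPolynomial (Fin n) (ZMod 2))) (ρ : MFTri.ChoiceRule),
        MFTri.IsInput PS L → (∀ P ∈ PS, P.totalDegree ≤ d) →
        ∃ (o : MFTri.Output) (t : ℕ), MFTri.Runs n ρ (MFTri.start L) o t ∧
          t ≤ p.eval (MFTri.inputSize PS)) := by
  -- The larger of `1200 * 3` and `1200 * 4`. The factors 3 and 4 absorb the additive constants of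
  -- `termBound PS + 1` into the sum of the terms and into `n * PS.sup term`.
  refine ⟨⟨4800, fun n d PS L ρ hn h h0 hd => ?_⟩, fun d => ?_⟩
  · obtain ⟨o, t, hr, ht⟩ := MFTri.exists_runs_le ρ hn h h0 hd
    obtain ⟨-, hT, hM⟩ := MFTri.one_le_sum_term h0
    refine ⟨o, t, hr, ?_, fun _ => ?_⟩
    · have hb : MFTri.termBound PS + 1 ≤ 3 * ∑ P ∈ PS, MFTri.term P := by
        have := min_le_left (∑ P ∈ PS, MFTri.term P) ((n + 1) * PS.sup MFTri.term)
        rw [MFTri.termBound]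
        omega
      calc t ≤ _ := ht
        _ ≤ 1200 * (PS.card * n ^ (d + 1) * (3 * ∑ P ∈ PS, MFTri.term P)) := by gcongr
        _ = 3600 * (PS.card * n ^ (d + 1) * ∑ P ∈ PS, MFTri.term P) := by ring
        _ ≤ _ := by gcongr; omega
    · have hb : MFTri.termBound PS + 1 ≤ 4 * (n * PS.sup MFTri.term) := by
        have := min_le_right (∑ P ∈ PS, MFTri.term P) ((n + 1) * PS.sup MFTri.term)
        rw [MFTri.termBound]
        nlinarith [Nat.mul_le_mul hn hM]
      calc t ≤ _ := ht
        _ ≤ 1200 * (PS.card * n ^ (d + 1) * (4 * (n * PS.sup MFTri.term))) := by gcongr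
        _ = _ := by ring
  -- The bound of `exists_runs` at `k = 0`, with the number of variables, of polynomials and of
  -- terms each replaced by the input size, and the weight estimated by `potential_le_pow`.
  · refine ⟨(Polynomial.X + 1) * (50 * ((Polynomial.X + 1) * (Polynomial.X + 2)) *
      (Polynomial.X + 2 * (Polynomial.X * (Polynomial.X + 1) ^ d) + 1)), ?_⟩
    intro n PS L ρ h hd
    simp only [Polynomial.eval_mul, Polynomial.eval_add, Polynomial.eval_pow, Polynomial.eval_X,
      Polynomial.eval_one, Polynomial.eval_ofNat]
    obtain ⟨hl, hT⟩ := MFTri.term_le_inputSize PS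
    by_cases h0 : ∃ P ∈ PS, P ≠ 0
    · have hn := MFTri.le_inputSize h0
      obtain ⟨o, t, hr, ht⟩ := MFTri.exists_runs (k := 0) ρ h hd (.inl rfl)
      refine ⟨o, t, hr, ht.trans ?_⟩
      have hb : MFTri.termBound PS + 1 ≤ MFTri.inputSize PS + 2 := by
        have := min_le_left (∑ P ∈ PS, MFTri.term P) ((n + 1) * PS.sup MFTri.term)
        rw [MFTri.termBound]
        omega
      have hp := MFTri.potential_le_pow n d
      have hp' := hp.trans (Nat.pow_le_pow_left (Nat.add_le_add_right hn 1) d)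
      rw [Nat.sub_zero]
      gcongr
    · push Not at h0
      obtain ⟨o, t, hr, ht⟩ := MFTri.exists_runs_zero ρ h h0
      refine ⟨o, t, hr, ht.trans ?_⟩
      set s := MFTri.inputSize PS
      -- The value of the polynomial at zero is already 100.
      calc 6 ≤ (0 + 1) * (50 * ((0 + 1) * (0 + 2)) * (0 + 0 + 1)) := by norm_num
        _ ≤ _ := by gcongr <;> exact Nat.zero_le _
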